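/- **The meta-logic.** Let $FO\lambda^{\Delta\mathbb N}$ be the following intuitionistic sequent calculus. Terms are simply typed $\lambda$-terms up to $\alpha\beta\eta$-conversion, over ground types that include $nt, i, atm, prp, atmlst$, with infinitely many variables of each type. Formulas are built from atoms $p\,\bar t$ by $\bot,\top,\land,\lor,\supset,\forall_\tau,\exists_\tau$, where $\tau$ is any simple type not involving the type $o$ of formulas. A sequent $\Gamma\longrightarrow B$ has a finite multiset $\Gamma$ and a single formula $B$. The rules are the usual left and right rules for the connectives, initial sequents $A,\Gamma\longrightarrow A$ for atomic $A$, contraction, cut; the rules for $nat$: $$\frac{}{\Gamma\longrightarrow nat\,z}\qquad\frac{\Gamma\longrightarrow nat\,I}{\Gamma\longrightarrow nat\,(s\,I)}\qquad\frac{\longrightarrow B\,z\quad B\,j\longrightarrow B\,(s\,j)\quad B\,I,\Gamma\longrightarrow C}{nat\,I,\Gamma\longrightarrow C}\ (j\text{ not free in }B);$$ and, relative to a *definition* $\mathcal D$, i.e. a possibly infinite set of clauses $\forall\bar x[p\,\bar t\triangleq B]$ without free variables, the rules for atoms with a predicate other than $nat$: from $\Gamma\longrightarrow B\theta$ infer $\Gamma\longrightarrow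 p\,\bar u$ if $p\,\bar u=(p\,\bar t)\theta$ for some clause; and infer $p\,\bar u,\Gamma\longrightarrow C$ from all the sequents $B\theta,\Gamma\theta\longrightarrow C\theta$, where $\theta$ runs through a complete set of unifiers of $p\,\bar u$ and the head of a clause, for every clause of $\mathcal D$. Each predicate $p$ has a level $\mathrm{lvl}(p)\in\mathbb N$, extended to formulas by $\mathrm{lvl}(p\,\bar t)=\mathrm{lvl}(p)$, $\mathrm{lvl}(\top)=\mathrm{lvl}(\bot)=0$, maxima for $\land,\lor$, $\mathrm{lvl}(B\supset C)=\max(\mathrm{lvl}(B)+1,\mathrm{lvl}(C))$, and no change under quantifiers; every clause $\forall\bar x[p\,\bar t\triangleq B]$ of a definition must satisfy $\mathrm{lvl}(B)\le\mathrm{lvl}(p)$. **The encoding.** There are constants $z:nt$, $s:nt\to nt$, $nil:atmlst$, $::\;:atm\to atmlst\to atmlst$, $\langle\cdot\rangle:atm\to prp$, $tt:prp$, $\&:prp\to prp\to prp$, $\Rightarrow\;:atm\to prp\to prp$, $\bigwedge_i:(i\to prp)\to prp$, and arbitrary further constants. $\mathcal D(nat)$ consists of the clauses $$I=I\triangleq\top,\quad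 sum\,z\,J\,J\triangleq nat\,J,\quad sum\,(s\,I)\,J\,(s\,K)\triangleq sum\,I\,J\,K,\quad z<s\,J\triangleq nat\,J,\quad s\,I<s\,J\triangleq I<J,\quad I\le I\triangleq\top,\quad I\le J\triangleq I<J.$$ $\mathcal D_{list}(atm)$ consists of $$\begin{aligned}&length\,nil\,z\triangleq\top,\quad length\,(X::L)\,(s\,I)\triangleq length\,L\,I,\quad list\,L\triangleq\exists i(nat\,i\land length\,L\,i),\\&element\,X\,(X::L)\triangleq\top,\quad element\,X\,(Y::L)\triangleq element\,X\,L,\quad split\,nil\,nil\,nil\triangleq\top,\\&split\,(X::L_1)\,(X::L_2)\,L_3\triangleq split\,L_1\,L_2\,L_3,\quad split\,(X::L_1)\,L_2\,(X::L_3)\triangleq split\,L_1\,L_2\,L_3,\\&permute\,nil\,nil\triangleq\top,\quad permute\,(X::L_1)\,L_2\triangleq\exists l(split\,L_2\,(X::nil)\,l\land permute\,L_1\,l).\end{aligned}$$ $\mathcal D(intuit)$ consists of $$\begin{aligned}&seq_I\,(A'::L)\,\langle A\rangle\triangleq element\,A\,(A'::L),\quad seq_I\,L\,tt\triangleq\top,\quad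 seq_{s I}\,L\,(B\,\&\,C)\triangleq seq_I\,L\,B\land seq_I\,L\,C,\\&seq_{sI}\,L\,(A\Rightarrow B)\triangleq seq_I\,(A::L)\,B,\quad seq_{sI}\,L\,(\textstyle\bigwedge_iB)\triangleq\forall_ix\;seq_I\,L\,(B\,x),\\&seq_{sI}\,L\,\langle A\rangle\triangleq\exists b(prog\,A\,b\land seq_I\,L\,b).\end{aligned}$$ Write $prv_L\,B$ for $\exists i(nat\,i\land seq_i\,L\,B)$. **The translation.** Formulas of the object-level intuitionistic logic have the terms of type $atm$ as atomic formulas and quantifiers over simply typed terms. A term $B$ of type $prp$ built with the constants above translates to a formula $[\![B]\!]$: $[\![\langle A\rangle]\!]=A$, $[\![tt]\!]=\top$, $[\![B\,\&\,C]\!]=[\![B]\!]\land[\![C]\!]$, $[\![A\Rightarrow B]\!]=A\Rightarrow[\![B]\!]$, $[\![\bigwedge_i\lambda x.B]\!]=\bigwedge_ix.[\![B]\!]$. A term $L=A_1::\cdots::A_m::nil$ of type $atmlst$ translates to the multiset $[\![L]\!]=\{A_1,\dots,A_m\}$. **Theorem (Adequacy of Encoding Intuitionistic Logic).** Let $n\ge0$,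 let $\mathcal D(prog)=\{\forall\bar x_1[prog\,A_1\,G_1\triangleq\top],\dots,\forall\bar x_n[prog\,A_n\,G_n\triangleq\top]\}$, where each $G_k$ has a translation and the variables $\bar x_k$ have any simple types, and let $\mathcal P$ be the set of the formulas $\bigwedge\bar x_k([\![G_k]\!]\Rightarrow A_k)$, $1\le k\le n$. Let $\mathcal D$ be a definition that extends $\mathcal D(nat)\cup\mathcal D_{list}(atm)\cup\mathcal D(intuit)\cup\mathcal D(prog)$ by clauses whose heads have predicates other than $nat$, $seq$, $element$, $prog$. Let $L$ and $B$ be terms of types $atmlst$ and $prp$ that have translations. Then $\longrightarrow prv_L\,B$ is derivable in $FO\lambda^{\Delta\mathbb N}$ with definition $\mathcal D$ if and only if $[\![B]\!]$ is an intuitionistic consequence of $[\![L]\!]\cup\mathcal P$. -/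

import Mathlib

universe u

namespace FOLambda

/-! ## Types, signatures and simply typed terms -/

/-- Ground types: natural numbers `nt`, object-level terms `i`, object-level atoms `atm`,
object-level goal formulas `prp`, lists of atoms `atmlst`, and any further ground types.
The type `o` of formulas is not among them, so no quantified type contains `o`. -/
inductive Base (U : Type u) : Type u
  | nt | i | atm | prp | atmlst
  | other (b : U)

/-- Simple types over the ground types. -/
inductive Ty (U : Type u) : Type u
  | base (b : Base U)
  | arr (σ τ : Ty U)

namespace Ty
variable {U : Type u}
abbrev nt : Ty U := .base .nt
abbrev i : Ty U := .base .i
abbrev atm : Ty U := .base .atm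
abbrev prp : Ty U := .base .prp
abbrev atmlst : Ty U := .base .atmlst
end Ty

/-- The part of the language that is left open: further ground types, further typed constants
(such as the object-level function and predicate symbols) and further predicate symbols,
each with the list of its argument types. -/
structure Signature where
  Ground : Type u
  Con : Type u
  conTy : Con → Ty Ground
  Prd : Type u
  prdTy : Prd → List (Ty Ground)

/-- The typed constants. -/
inductive Const (S : Signature.{u}) : Ty S.Ground → Type u
  | zero : Const S .nt
  | suc : Const S (.arr .nt .nt)
  | nil : Const S .atmlst
  | cons : Const S (.arr .atm (.arr .atmlst .atmlst))
  | atom : Const S (.arr .atm .prp)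
  | tt : Const S .prp
  | and : Const S (.arr .prp (.arr .prp .prp))
  | imp : Const S (.arr .atm (.arr .prp .prp))
  | all : Const S (.arr (.arr .i .prp) .prp)
  | other (c : S.Con) : Const S (S.conTy c)

/-- Typed de Bruijn indices into a context. -/
inductive Var {T : Type u} : List T → T → Type u
  | zero {Γ : List T} {τ : T} : Var (τ :: Γ) τ
  | succ {Γ : List T} {σ τ : T} (x : Var Γ τ) : Var (σ :: Γ) τ

/-- Simply typed `λ`-terms whose indices refer to the context `Γ`. For every type `τ` and every
`n : N` there is moreover a named variable `free τ n` of type `τ`. Sequents use `N = ℕ`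
(infinitely many variables of each type), closed syntax uses `N = Empty`. -/
inductive Tm (S : Signature.{u}) (N : Type) : List (Ty S.Ground) → Ty S.Ground → Type u
  | bvar {Γ : List (Ty S.Ground)} {τ : Ty S.Ground} (x : Var Γ τ) : Tm S N Γ τ
  | free {Γ : List (Ty S.Ground)} (τ : Ty S.Ground) (n : N) : Tm S N Γ τ
  | const {Γ : List (Ty S.Ground)} {τ : Ty S.Ground} (c : Const S τ) : Tm S N Γ τ
  | app {Γ : List (Ty S.Ground)} {σ τ : Ty S.Ground}
      (t : Tm S N Γ (.arr σ τ)) (t' : Tm S N Γ σ) : Tm S N Γ τ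
  | lam {Γ : List (Ty S.Ground)} {σ τ : Ty S.Ground}
      (t : Tm S N (σ :: Γ) τ) : Tm S N Γ (.arr σ τ)

section Terms
variable {S : Signature.{u}} {N N' : Type}

/-- Assignments of terms to the indices of a context. -/
abbrev Assign (S : Signature.{u}) (N : Type) (Γ Δ : List (Ty S.Ground)) : Type u :=
  ∀ τ : Ty S.Ground, Var Γ τ → Tm S N Δ τ

/-- Assignments of terms to the named variables. -/
abbrev NameSubst (S : Signature.{u}) (N N' : Type) (Δ : List (Ty S.Ground)) : Type u :=
  ∀ τ : Ty S.Ground, N → Tm S N' Δ τ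

def Var.lift {T : Type u} {Γ Δ : List T} (ρ : ∀ τ : T, Var Γ τ → Var Δ τ) (σ : T) :
    ∀ τ : T, Var (σ :: Γ) τ → Var (σ :: Δ) τ
  | _, .zero => .zero
  | _, .succ x => .succ (ρ _ x)

def Tm.rename {Γ Δ : List (Ty S.Ground)} {τ : Ty S.Ground}
    (ρ : ∀ τ : Ty S.Ground, Var Γ τ → Var Δ τ) : Tm S N Γ τ → Tm S N Δ τ
  | .bvar x => .bvar (ρ _ x)
  | .free τ n => .free τ n
  | .const c => .const c
  | .app t t' => .app (t.rename ρ) (t'.rename ρ)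
  | .lam t => .lam (t.rename (Var.lift ρ _))

/-- Weakening by one index. -/
def Tm.wk {Γ : List (Ty S.Ground)} {σ τ : Ty S.Ground} (t : Tm S N Γ τ) : Tm S N (σ :: Γ) τ :=
  t.rename fun _ x => .succ x

def NameSubst.wk {Δ : List (Ty S.Ground)} (θ : NameSubst S N N' Δ) (σ : Ty S.Ground) :
    NameSubst S N N' (σ :: Δ) :=
  fun τ n => (θ τ n).wk

def Assign.lift {Γ Δ : List (Ty S.Ground)} (η : Assign S N Γ Δ) (σ : Ty S.Ground) :
    Assign S N (σ :: Γ) (σ :: Δ)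
  | _, .zero => .bvar .zero
  | _, .succ x => (η _ x).wk

/-- Simultaneous capture-avoiding substitution for the named variables (by `θ`) and the
indices (by `η`). -/
def Tm.bind {Γ Δ : List (Ty S.Ground)} {τ : Ty S.Ground}
    (θ : NameSubst S N N' Δ) (η : Assign S N' Γ Δ) : Tm S N Γ τ → Tm S N' Δ τ
  | .bvar x => η _ x
  | .free τ n => θ τ n
  | .const c => .const c
  | .app t t' => .app (t.bind θ η) (t'.bind θ η)
  | .lam t => .lam (t.bind (θ.wk _) (η.lift _))

/-- The assignment that replaces index `0` by `t` and lowers the other indices. -/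
def Assign.single {Γ : List (Ty S.Ground)} {σ : Ty S.Ground} (t : Tm S N Γ σ) :
    Assign S N (σ :: Γ) Γ
  | _, .zero => t
  | _, .succ x => .bvar x

/-- The assignment on the empty context. -/
def Assign.none {Δ : List (Ty S.Ground)} : Assign S N [] Δ := fun _ x => nomatch x

/-- `b[t/x]` for terms. -/
def Tm.inst {Γ : List (Ty S.Ground)} {σ τ : Ty S.Ground} (b : Tm S N (σ :: Γ) τ)
    (t : Tm S N Γ σ) : Tm S N Γ τ :=
  b.bind (fun τ n => .free τ n) (Assign.single t)

/-- The named variable `n` of type `τ` occurs in the term. -/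
def Tm.Occurs (τ : Ty S.Ground) (n : N) {Γ : List (Ty S.Ground)} {τ' : Ty S.Ground} :
    Tm S N Γ τ' → Prop
  | .bvar _ => False
  | .free τ'' m => τ'' = τ ∧ m = n
  | .const _ => False
  | .app t t' => t.Occurs τ n ∨ t'.Occurs τ n
  | .lam t => t.Occurs τ n

/-- `βη`-convertibility (`α`-conversion is built into de Bruijn indices). -/
inductive Tm.Conv : {Γ : List (Ty S.Ground)} → {τ : Ty S.Ground} →
    Tm S N Γ τ → Tm S N Γ τ → Prop
  | refl {Γ : List (Ty S.Ground)} {τ : Ty S.Ground} (t : Tm S N Γ τ) : Conv t t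
  | symm {Γ : List (Ty S.Ground)} {τ : Ty S.Ground} {t t' : Tm S N Γ τ} :
      Conv t t' → Conv t' t
  | trans {Γ : List (Ty S.Ground)} {τ : Ty S.Ground} {t t' t'' : Tm S N Γ τ} :
      Conv t t' → Conv t' t'' → Conv t t''
  | app {Γ : List (Ty S.Ground)} {σ τ : Ty S.Ground} {t t' : Tm S N Γ (.arr σ τ)}
      {r r' : Tm S N Γ σ} : Conv t t' → Conv r r' → Conv (.app t r) (.app t' r')
  | lam {Γ : List (Ty S.Ground)} {σ τ : Ty S.Ground} {t t' : Tm S N (σ :: Γ) τ} :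
      Conv t t' → Conv (.lam t) (.lam t')
  | beta {Γ : List (Ty S.Ground)} {σ τ : Ty S.Ground} (t : Tm S N (σ :: Γ) τ)
      (r : Tm S N Γ σ) : Conv (.app (.lam t) r) (t.inst r)
  | eta {Γ : List (Ty S.Ground)} {σ τ : Ty S.Ground} (t : Tm S N Γ (.arr σ τ)) :
      Conv (.lam (.app t.wk (.bvar .zero))) t

/-- Lists of terms of given types. -/
inductive Tms (S : Signature.{u}) (N : Type) (Γ : List (Ty S.Ground)) :
    List (Ty S.Ground) → Type u
  | nil : Tms S N Γ []
  | cons {τ : Ty S.Ground} {τs : List (Ty S.Ground)} (t : Tm S N Γ τ) (ts : Tms S N Γ τs) :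
      Tms S N Γ (τ :: τs)

def Tms.bind {Γ Δ τs : List (Ty S.Ground)} (θ : NameSubst S N N' Δ) (η : Assign S N' Γ Δ) :
    Tms S N Γ τs → Tms S N' Δ τs
  | .nil => .nil
  | .cons t ts => .cons (t.bind θ η) (ts.bind θ η)

def Tms.Occurs (τ : Ty S.Ground) (n : N) {Γ τs : List (Ty S.Ground)} : Tms S N Γ τs → Prop
  | .nil => False
  | .cons t ts => t.Occurs τ n ∨ ts.Occurs τ n

inductive Tms.Conv {Γ : List (Ty S.Ground)} : {τs : List (Ty S.Ground)} →
    Tms S N Γ τs → Tms S N Γ τs → Prop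
  | nil : Conv .nil .nil
  | cons {τ : Ty S.Ground} {τs : List (Ty S.Ground)} {t t' : Tm S N Γ τ} {ts ts' : Tms S N Γ τs} :
      t.Conv t' → Conv ts ts' → Conv (.cons t ts) (.cons t' ts')

end Terms

/-! ## Formulas

Formulas over a vocabulary `P` of predicate symbols with argument types `ar`. The same syntax
serves for the meta-logic and for the object logic; only the vocabularies differ. -/

inductive Form (S : Signature.{u}) {P : Type u} (ar : P → List (Ty S.Ground)) (N : Type) :
    List (Ty S.Ground) → Type u
  | atom {Γ : List (Ty S.Ground)} (p : P) (ts : Tms S N Γ (ar p)) : Form S ar N Γ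
  | top {Γ : List (Ty S.Ground)} : Form S ar N Γ
  | bot {Γ : List (Ty S.Ground)} : Form S ar N Γ
  | and {Γ : List (Ty S.Ground)} (B C : Form S ar N Γ) : Form S ar N Γ
  | or {Γ : List (Ty S.Ground)} (B C : Form S ar N Γ) : Form S ar N Γ
  | imp {Γ : List (Ty S.Ground)} (B C : Form S ar N Γ) : Form S ar N Γ
  | all {Γ : List (Ty S.Ground)} (τ : Ty S.Ground) (B : Form S ar N (τ :: Γ)) : Form S ar N Γ
  | ex {Γ : List (Ty S.Ground)} (τ : Ty S.Ground) (B : Form S ar N (τ :: Γ)) : Form S ar N Γ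

section Formulas
variable {S : Signature.{u}} {P : Type u} {ar : P → List (Ty S.Ground)} {N N' : Type}

def Form.bind {Γ Δ : List (Ty S.Ground)} (θ : NameSubst S N N' Δ) (η : Assign S N' Γ Δ) :
    Form S ar N Γ → Form S ar N' Δ
  | .atom p ts => .atom p (ts.bind θ η)
  | .top => .top
  | .bot => .bot
  | .and B C => .and (B.bind θ η) (C.bind θ η)
  | .or B C => .or (B.bind θ η) (C.bind θ η)
  | .imp B C => .imp (B.bind θ η) (C.bind θ η)
  | .all τ B => .all τ (B.bind (θ.wk τ) (η.lift τ))
  | .ex τ B => .ex τ (B.bind (θ.wk τ) (η.lift τ))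

/-- `B[t/x]` for formulas. -/
def Form.inst {Γ : List (Ty S.Ground)} {σ : Ty S.Ground} (B : Form S ar N (σ :: Γ))
    (t : Tm S N Γ σ) : Form S ar N Γ :=
  B.bind (fun τ n => .free τ n) (Assign.single t)

/-- The named variable `n` of type `τ` occurs in the formula. -/
def Form.Occurs (τ : Ty S.Ground) (n : N) {Γ : List (Ty S.Ground)} : Form S ar N Γ → Prop
  | .atom _ ts => ts.Occurs τ n
  | .top => False
  | .bot => False
  | .and B C => B.Occurs τ n ∨ C.Occurs τ n
  | .or B C => B.Occurs τ n ∨ C.Occurs τ n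
  | .imp B C => B.Occurs τ n ∨ C.Occurs τ n
  | .all _ B => B.Occurs τ n
  | .ex _ B => B.Occurs τ n

/-- `βη`-convertibility of formulas. -/
inductive Form.Conv : {Γ : List (Ty S.Ground)} → Form S ar N Γ → Form S ar N Γ → Prop
  | atom {Γ : List (Ty S.Ground)} (p : P) {ts ts' : Tms S N Γ (ar p)} :
      ts.Conv ts' → Conv (.atom p ts) (.atom p ts')
  | top {Γ : List (Ty S.Ground)} : Conv (.top (Γ := Γ)) .top
  | bot {Γ : List (Ty S.Ground)} : Conv (.bot (Γ := Γ)) .bot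
  | and {Γ : List (Ty S.Ground)} {B B' C C' : Form S ar N Γ} :
      Conv B B' → Conv C C' → Conv (.and B C) (.and B' C')
  | or {Γ : List (Ty S.Ground)} {B B' C C' : Form S ar N Γ} :
      Conv B B' → Conv C C' → Conv (.or B C) (.or B' C')
  | imp {Γ : List (Ty S.Ground)} {B B' C C' : Form S ar N Γ} :
      Conv B B' → Conv C C' → Conv (.imp B C) (.imp B' C')
  | all {Γ : List (Ty S.Ground)} (τ : Ty S.Ground) {B B' : Form S ar N (τ :: Γ)} :
      Conv B B' → Conv (.all τ B) (.all τ B')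
  | ex {Γ : List (Ty S.Ground)} (τ : Ty S.Ground) {B B' : Form S ar N (τ :: Γ)} :
      Conv B B' → Conv (.ex τ B) (.ex τ B')

/-- The level of a formula, given the levels of the predicate symbols. -/
def Form.level (lvl : P → ℕ) {Γ : List (Ty S.Ground)} : Form S ar N Γ → ℕ
  | .atom p _ => lvl p
  | .top => 0
  | .bot => 0
  | .and B C => max (B.level lvl) (C.level lvl)
  | .or B C => max (B.level lvl) (C.level lvl)
  | .imp B C => max (B.level lvl + 1) (C.level lvl)
  | .all _ B => B.level lvl
  | .ex _ B => B.level lvl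

/-- Universal closure: the quantifier prefix over all indices of the context. -/
def Form.close : (Γ : List (Ty S.Ground)) → Form S ar N Γ → Form S ar N []
  | [], B => B
  | τ :: Γ, B => Form.close Γ (.all τ B)

/-- A formula without named variables, read as a formula that may have some. -/
def Form.ofClosed {Γ : List (Ty S.Ground)} (B : Form S ar Empty Γ) : Form S ar N Γ :=
  B.bind (fun _ n => n.elim) (fun _ x => .bvar x)

end Formulas

/-! ## The meta-logic -/

/-- The predicate symbols of the meta-logic. -/
inductive Pred (S : Signature.{u}) : Type u
  | nat | eq | lt | le | sum
  | length | list | element | split | permute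
  | seq | prog
  | other (p : S.Prd)

def Pred.arity {S : Signature.{u}} : Pred S → List (Ty S.Ground)
  | .nat => [.nt]
  | .eq => [.nt, .nt]
  | .lt => [.nt, .nt]
  | .le => [.nt, .nt]
  | .sum => [.nt, .nt, .nt]
  | .length => [.atmlst, .nt]
  | .list => [.atmlst]
  | .element => [.atm, .atmlst]
  | .split => [.atmlst, .atmlst, .atmlst]
  | .permute => [.atmlst, .atmlst]
  | .seq => [.nt, .atmlst, .prp]
  | .prog => [.atm, .prp]
  | .other p => S.prdTy p

/-- Formulas of the meta-logic. -/
abbrev MForm (S : Signature.{u}) (N : Type) (Γ : List (Ty S.Ground)) : Type u :=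
  Form S (Pred.arity (S := S)) N Γ

/-- A definitional clause `∀ x̄ [p t̄ ≜ B]`; `ctx` lists the types of `x̄`. There are no named
variables in a clause. That each variable of the body also occurs in the head is not demanded:
all such clauses are covered, and others too. -/
structure Clause (S : Signature.{u}) where
  ctx : List (Ty S.Ground)
  pred : Pred S
  args : Tms S Empty ctx pred.arity
  body : MForm S Empty ctx

section Derivations
variable {S : Signature.{u}}

def Clause.head (c : Clause S) : MForm S Empty c.ctx := .atom c.pred c.args

/-- The instance of a clause formula under an assignment of terms to the clause variables. -/
def Clause.formInst {Γ : List (Ty S.Ground)} (B : MForm S Empty Γ) (η : Assign S ℕ Γ []) :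
    MForm S ℕ [] :=
  B.bind (fun _ n => n.elim) η

/-- Substitution for the named variables of a formula. -/
def MForm.subst (θ : NameSubst S ℕ ℕ []) (B : MForm S ℕ []) : MForm S ℕ [] :=
  B.bind θ Assign.none

def Tm.subst (θ : NameSubst S ℕ ℕ []) {τ : Ty S.Ground} (t : Tm S ℕ [] τ) : Tm S ℕ [] τ :=
  t.bind θ Assign.none

/-- A substitution for the named variables together with the variables of the clause `c`;
the two kinds of variables are distinct by construction. -/
structure ClauseSubst (c : Clause S) where
  names : NameSubst S ℕ ℕ []
  vars : Assign S ℕ c.ctx []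

/-- `π` unifies the formula `A` with the head of the clause `c`. -/
def IsUnifier (A : MForm S ℕ []) (c : Clause S) (π : ClauseSubst c) : Prop :=
  (A.subst π.names).Conv (Clause.formInst c.head π.vars)

/-- A complete set of unifiers of `A` and the head of `c`: it consists of unifiers, and every
unifier is, up to `βη`-conversion, a member followed by some substitution. -/
def IsCSU (A : MForm S ℕ []) (c : Clause S) (U : Set (ClauseSubst c)) : Prop :=
  (∀ π ∈ U, IsUnifier A c π) ∧
  ∀ ρ : ClauseSubst c, IsUnifier A c ρ → ∃ π ∈ U, ∃ σ : NameSubst S ℕ ℕ [],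
    (∀ (τ : Ty S.Ground) (n : ℕ), (ρ.names τ n).Conv ((π.names τ n).subst σ)) ∧
    (∀ (τ : Ty S.Ground) (x : Var c.ctx τ), (ρ.vars τ x).Conv ((π.vars τ x).subst σ))

/-- Zero and successor. -/
def zeroT {N : Type} {Γ : List (Ty S.Ground)} : Tm S N Γ .nt := .const .zero
def sucT {N : Type} {Γ : List (Ty S.Ground)} (t : Tm S N Γ .nt) : Tm S N Γ .nt :=
  .app (.const .suc) t

/-- The atomic formula `nat t`. -/
def natF {N : Type} {Γ : List (Ty S.Ground)} (t : Tm S N Γ .nt) : MForm S N Γ :=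
  .atom .nat (.cons t .nil)

/-- The sequent `Γ ⟶ B` is derivable in the meta-logic with the definition `D`. Formulas are
identified up to `βη`-conversion, which is the rule `conv`. The predicate `nat` is not a defined
predicate: it has rules of its own, and the definition rules do not apply to it. -/
inductive Derivable (D : Set (Clause S)) : Multiset (MForm S ℕ []) → MForm S ℕ [] → Prop
  | conv {Γ Γ' : Multiset (MForm S ℕ [])} {B B' : MForm S ℕ []} :
      Multiset.Rel Form.Conv Γ Γ' → B.Conv B' → Derivable D Γ B → Derivable D Γ' B'
  | botL {Γ : Multiset (MForm S ℕ [])} {B : MForm S ℕ []} : Derivable D (.bot ::ₘ Γ) B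
  | topR {Γ : Multiset (MForm S ℕ [])} : Derivable D Γ .top
  | andL₁ {Γ : Multiset (MForm S ℕ [])} {B C E : MForm S ℕ []} :
      Derivable D (B ::ₘ Γ) E → Derivable D (.and B C ::ₘ Γ) E
  | andL₂ {Γ : Multiset (MForm S ℕ [])} {B C E : MForm S ℕ []} :
      Derivable D (C ::ₘ Γ) E → Derivable D (.and B C ::ₘ Γ) E
  | andR {Γ : Multiset (MForm S ℕ [])} {B C : MForm S ℕ []} :
      Derivable D Γ B → Derivable D Γ C → Derivable D Γ (.and B C)
  | orL {Γ : Multiset (MForm S ℕ [])} {B C E : MForm S ℕ []} :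
      Derivable D (B ::ₘ Γ) E → Derivable D (C ::ₘ Γ) E → Derivable D (.or B C ::ₘ Γ) E
  | orR₁ {Γ : Multiset (MForm S ℕ [])} {B C : MForm S ℕ []} :
      Derivable D Γ B → Derivable D Γ (.or B C)
  | orR₂ {Γ : Multiset (MForm S ℕ [])} {B C : MForm S ℕ []} :
      Derivable D Γ C → Derivable D Γ (.or B C)
  | impL {Γ : Multiset (MForm S ℕ [])} {B C E : MForm S ℕ []} :
      Derivable D Γ B → Derivable D (C ::ₘ Γ) E → Derivable D (.imp B C ::ₘ Γ) E
  | impR {Γ : Multiset (MForm S ℕ [])} {B C : MForm S ℕ []} :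
      Derivable D (B ::ₘ Γ) C → Derivable D Γ (.imp B C)
  | allL {Γ : Multiset (MForm S ℕ [])} {τ : Ty S.Ground} {B : MForm S ℕ [τ]} {C : MForm S ℕ []}
      (t : Tm S ℕ [] τ) : Derivable D (B.inst t ::ₘ Γ) C → Derivable D (.all τ B ::ₘ Γ) C
  | allR {Γ : Multiset (MForm S ℕ [])} {τ : Ty S.Ground} {B : MForm S ℕ [τ]} (y : ℕ) :
      (∀ F ∈ Γ, ¬ F.Occurs τ y) → ¬ B.Occurs τ y →
      Derivable D Γ (B.inst (.free τ y)) → Derivable D Γ (.all τ B)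
  | exL {Γ : Multiset (MForm S ℕ [])} {τ : Ty S.Ground} {B : MForm S ℕ [τ]} {C : MForm S ℕ []}
      (y : ℕ) :
      (∀ F ∈ Γ, ¬ F.Occurs τ y) → ¬ B.Occurs τ y → ¬ C.Occurs τ y →
      Derivable D (B.inst (.free τ y) ::ₘ Γ) C → Derivable D (.ex τ B ::ₘ Γ) C
  | exR {Γ : Multiset (MForm S ℕ [])} {τ : Ty S.Ground} {B : MForm S ℕ [τ]} (t : Tm S ℕ [] τ) :
      Derivable D Γ (B.inst t) → Derivable D Γ (.ex τ B)
  | init {Γ : Multiset (MForm S ℕ [])} (p : Pred S) (ts : Tms S ℕ [] p.arity) :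
      Derivable D (.atom p ts ::ₘ Γ) (.atom p ts)
  | contrL {Γ : Multiset (MForm S ℕ [])} {B C : MForm S ℕ []} :
      Derivable D (B ::ₘ B ::ₘ Γ) C → Derivable D (B ::ₘ Γ) C
  | cut {Δ Γ : Multiset (MForm S ℕ [])} {B C : MForm S ℕ []} :
      Derivable D Δ B → Derivable D (B ::ₘ Γ) C → Derivable D (Δ + Γ) C
  | natR_zero {Γ : Multiset (MForm S ℕ [])} : Derivable D Γ (natF zeroT)
  | natR_suc {Γ : Multiset (MForm S ℕ [])} {I : Tm S ℕ [] .nt} :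
      Derivable D Γ (natF I) → Derivable D Γ (natF (sucT I))
  | natL {Γ : Multiset (MForm S ℕ [])} {I : Tm S ℕ [] .nt} {C : MForm S ℕ []}
      (B : MForm S ℕ [.nt]) (j : ℕ) : ¬ B.Occurs .nt j →
      Derivable D 0 (B.inst zeroT) →
      Derivable D {B.inst (.free .nt j)} (B.inst (sucT (.free .nt j))) →
      Derivable D (B.inst I ::ₘ Γ) C → Derivable D (natF I ::ₘ Γ) C
  | defR {Γ : Multiset (MForm S ℕ [])} (p : Pred S) (us : Tms S ℕ [] p.arity) (c : Clause S)
      (η : Assign S ℕ c.ctx []) : p ≠ .nat → c ∈ D →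
      (Form.atom p us : MForm S ℕ []).Conv (Clause.formInst c.head η) →
      Derivable D Γ (Clause.formInst c.body η) → Derivable D Γ (.atom p us)
  | defL {Γ : Multiset (MForm S ℕ [])} {C : MForm S ℕ []} (p : Pred S)
      (us : Tms S ℕ [] p.arity) (U : (c : Clause S) → Set (ClauseSubst c)) : p ≠ .nat →
      (∀ c ∈ D, IsCSU (.atom p us) c (U c)) →
      (∀ c ∈ D, ∀ π ∈ U c,
        Derivable D (Clause.formInst c.body π.vars ::ₘ Γ.map (MForm.subst π.names))
          (C.subst π.names)) →
      Derivable D (.atom p us ::ₘ Γ) C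

end Derivations

/-! ## The definitions of the predicates -/

section Definitions
variable {S : Signature.{u}} {N : Type} {Γ : List (Ty S.Ground)}

def nilT : Tm S N Γ .atmlst := .const .nil
def consT (a : Tm S N Γ .atm) (l : Tm S N Γ .atmlst) : Tm S N Γ .atmlst :=
  .app (.app (.const .cons) a) l
/-- The coercion of atoms to goal formulas. -/
def atomT (a : Tm S N Γ .atm) : Tm S N Γ .prp := .app (.const .atom) a
def ttT : Tm S N Γ .prp := .const .tt
def andT (b c : Tm S N Γ .prp) : Tm S N Γ .prp := .app (.app (.const .and) b) c
def impT (a : Tm S N Γ .atm) (b : Tm S N Γ .prp) : Tm S N Γ .prp := .app (.app (.const .imp) a) b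
def allT (b : Tm S N Γ (.arr .i .prp)) : Tm S N Γ .prp := .app (.const .all) b

def eqF (a b : Tm S N Γ .nt) : MForm S N Γ := .atom .eq (.cons a (.cons b .nil))
def ltF (a b : Tm S N Γ .nt) : MForm S N Γ := .atom .lt (.cons a (.cons b .nil))
def lengthF (l : Tm S N Γ .atmlst) (n : Tm S N Γ .nt) : MForm S N Γ :=
  .atom .length (.cons l (.cons n .nil))
def sumF (a b c : Tm S N Γ .nt) : MForm S N Γ := .atom .sum (.cons a (.cons b (.cons c .nil)))
def elementF (a : Tm S N Γ .atm) (l : Tm S N Γ .atmlst) : MForm S N Γ :=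
  .atom .element (.cons a (.cons l .nil))
def splitF (k l m : Tm S N Γ .atmlst) : MForm S N Γ :=
  .atom .split (.cons k (.cons l (.cons m .nil)))
def permuteF (k l : Tm S N Γ .atmlst) : MForm S N Γ := .atom .permute (.cons k (.cons l .nil))
def seqF (n : Tm S N Γ .nt) (l : Tm S N Γ .atmlst) (b : Tm S N Γ .prp) : MForm S N Γ :=
  .atom .seq (.cons n (.cons l (.cons b .nil)))
def progF (a : Tm S N Γ .atm) (b : Tm S N Γ .prp) : MForm S N Γ :=
  .atom .prog (.cons a (.cons b .nil))

/-- The first four indices. -/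
abbrev v0 {σ₀ : Ty S.Ground} : Tm S N (σ₀ :: Γ) σ₀ := .bvar .zero
abbrev v1 {σ₀ σ₁ : Ty S.Ground} : Tm S N (σ₀ :: σ₁ :: Γ) σ₁ := .bvar (.succ .zero)
abbrev v2 {σ₀ σ₁ σ₂ : Ty S.Ground} : Tm S N (σ₀ :: σ₁ :: σ₂ :: Γ) σ₂ :=
  .bvar (.succ (.succ .zero))
abbrev v3 {σ₀ σ₁ σ₂ σ₃ : Ty S.Ground} : Tm S N (σ₀ :: σ₁ :: σ₂ :: σ₃ :: Γ) σ₃ :=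
  .bvar (.succ (.succ (.succ .zero)))

/-- The clauses for the predicates on natural numbers. -/
def defNat (S : Signature.{u}) : Set (Clause S) :=
  { -- I = I ≜ ⊤
    ⟨[.nt], .eq, .cons v0 (.cons v0 .nil), .top⟩,
    -- sum z J J ≜ nat J
    ⟨[.nt], .sum, .cons zeroT (.cons v0 (.cons v0 .nil)), natF v0⟩,
    -- sum (s I) J (s K) ≜ sum I J K
    ⟨[.nt, .nt, .nt], .sum, .cons (sucT v0) (.cons v1 (.cons (sucT v2) .nil)), sumF v0 v1 v2⟩,
    -- z < s J ≜ nat J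
    ⟨[.nt], .lt, .cons zeroT (.cons (sucT v0) .nil), natF v0⟩,
    -- s I < s J ≜ I < J
    ⟨[.nt, .nt], .lt, .cons (sucT v0) (.cons (sucT v1) .nil), ltF v0 v1⟩,
    -- I ≤ I ≜ ⊤
    ⟨[.nt], .le, .cons v0 (.cons v0 .nil), .top⟩,
    -- I ≤ J ≜ I < J
    ⟨[.nt, .nt], .le, .cons v0 (.cons v1 .nil), ltF v0 v1⟩ }

/-- The clauses for the predicates on lists of atoms. -/
def defList (S : Signature.{u}) : Set (Clause S) :=
  { -- length nil z ≜ ⊤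
    ⟨[], .length, .cons nilT (.cons zeroT .nil), .top⟩,
    -- length (X :: L) (s I) ≜ length L I
    ⟨[.atm, .atmlst, .nt], .length, .cons (consT v0 v1) (.cons (sucT v2) .nil), lengthF v1 v2⟩,
    -- list L ≜ ∃ i (nat i ∧ length L i)
    ⟨[.atmlst], .list, .cons v0 .nil, .ex .nt (.and (natF v0) (lengthF v1 v0))⟩,
    -- element X (X :: L) ≜ ⊤
    ⟨[.atm, .atmlst], .element, .cons v0 (.cons (consT v0 v1) .nil), .top⟩,
    -- element X (Y :: L) ≜ element X L
    ⟨[.atm, .atm, .atmlst], .element, .cons v0 (.cons (consT v1 v2) .nil), elementF v0 v2⟩,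
    -- split nil nil nil ≜ ⊤
    ⟨[], .split, .cons nilT (.cons nilT (.cons nilT .nil)), .top⟩,
    -- split (X :: L₁) (X :: L₂) L₃ ≜ split L₁ L₂ L₃
    ⟨[.atm, .atmlst, .atmlst, .atmlst], .split,
      .cons (consT v0 v1) (.cons (consT v0 v2) (.cons v3 .nil)), splitF v1 v2 v3⟩,
    -- split (X :: L₁) L₂ (X :: L₃) ≜ split L₁ L₂ L₃
    ⟨[.atm, .atmlst, .atmlst, .atmlst], .split,
      .cons (consT v0 v1) (.cons v2 (.cons (consT v0 v3) .nil)), splitF v1 v2 v3⟩,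
    -- permute nil nil ≜ ⊤
    ⟨[], .permute, .cons nilT (.cons nilT .nil), .top⟩,
    -- permute (X :: L₁) L₂ ≜ ∃ l (split L₂ (X :: nil) l ∧ permute L₁ l)
    ⟨[.atm, .atmlst, .atmlst], .permute, .cons (consT v0 v1) (.cons v2 .nil),
      .ex .atmlst (.and (splitF v3 (consT v1 nilT) v0) (permuteF v2 v0))⟩ }

/-- The clauses for object-level sequents. -/
def defIntuit (S : Signature.{u}) : Set (Clause S) :=
  { -- seq I (A' :: L) ⟨A⟩ ≜ element A (A' :: L)
    ⟨[.nt, .atm, .atmlst, .atm], .seq, .cons v0 (.cons (consT v1 v2) (.cons (atomT v3) .nil)),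
      elementF v3 (consT v1 v2)⟩,
    -- seq I L tt ≜ ⊤
    ⟨[.nt, .atmlst], .seq, .cons v0 (.cons v1 (.cons ttT .nil)), .top⟩,
    -- seq (s I) L (B & C) ≜ seq I L B ∧ seq I L C
    ⟨[.nt, .atmlst, .prp, .prp], .seq, .cons (sucT v0) (.cons v1 (.cons (andT v2 v3) .nil)),
      .and (seqF v0 v1 v2) (seqF v0 v1 v3)⟩,
    -- seq (s I) L (A ⇒ B) ≜ seq I (A :: L) B
    ⟨[.nt, .atmlst, .atm, .prp], .seq, .cons (sucT v0) (.cons v1 (.cons (impT v2 v3) .nil)),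
      seqF v0 (consT v2 v1) v3⟩,
    -- seq (s I) L (⋀ B) ≜ ∀ x seq I L (B x)
    ⟨[.nt, .atmlst, .arr .i .prp], .seq, .cons (sucT v0) (.cons v1 (.cons (allT v2) .nil)),
      .all .i (seqF v1 v2 (.app v3 v0))⟩,
    -- seq (s I) L ⟨A⟩ ≜ ∃ b (prog A b ∧ seq I L b)
    ⟨[.nt, .atmlst, .atm], .seq, .cons (sucT v0) (.cons v1 (.cons (atomT v2) .nil)),
      .ex .prp (.and (progF v3 v0) (seqF v1 v2 v0))⟩ }

/-- `prv_L B`, that is `∃ i (nat i ∧ seq i L B)`. -/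
def prv (L : Tm S ℕ [] .atmlst) (B : Tm S ℕ [] .prp) : MForm S ℕ [] :=
  .ex .nt (.and (natF v0) (seqF v0 L.wk B.wk))

end Definitions

/-! ## The object logic -/

/-- The vocabulary of the object logic has one predicate symbol, with an argument of type `atm`:
the atomic formulas of the object logic are the terms of type `atm`. -/
def objArity (S : Signature.{u}) : PUnit.{u + 1} → List (Ty S.Ground) := fun _ => [.atm]

/-- Formulas of intuitionistic logic, with quantification at all simple types. -/
abbrev OForm (S : Signature.{u}) (N : Type) (Γ : List (Ty S.Ground)) : Type u :=
  Form S (objArity S) N Γ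

section ObjectLogic
variable {S : Signature.{u}} {N : Type}

/-- A term of type `atm` as an atomic formula. -/
def OForm.atm {Γ : List (Ty S.Ground)} (a : Tm S N Γ .atm) : OForm S N Γ :=
  .atom PUnit.unit (.cons a .nil)

/-- Intuitionistic consequence: natural deduction from a set of hypotheses, formulas being
identified up to `βη`-conversion. -/
inductive Entails : Set (OForm S ℕ []) → OForm S ℕ [] → Prop
  | hyp {H : Set (OForm S ℕ [])} {A : OForm S ℕ []} : A ∈ H → Entails H A
  | conv {H : Set (OForm S ℕ [])} {A B : OForm S ℕ []} : A.Conv B → Entails H A → Entails H B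
  | topI {H : Set (OForm S ℕ [])} : Entails H .top
  | botE {H : Set (OForm S ℕ [])} {A : OForm S ℕ []} : Entails H .bot → Entails H A
  | andI {H : Set (OForm S ℕ [])} {A B : OForm S ℕ []} :
      Entails H A → Entails H B → Entails H (.and A B)
  | andE₁ {H : Set (OForm S ℕ [])} {A B : OForm S ℕ []} : Entails H (.and A B) → Entails H A
  | andE₂ {H : Set (OForm S ℕ [])} {A B : OForm S ℕ []} : Entails H (.and A B) → Entails H B
  | orI₁ {H : Set (OForm S ℕ [])} {A B : OForm S ℕ []} : Entails H A → Entails H (.or A B)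
  | orI₂ {H : Set (OForm S ℕ [])} {A B : OForm S ℕ []} : Entails H B → Entails H (.or A B)
  | orE {H : Set (OForm S ℕ [])} {A B C : OForm S ℕ []} :
      Entails H (.or A B) → Entails (insert A H) C → Entails (insert B H) C → Entails H C
  | impI {H : Set (OForm S ℕ [])} {A B : OForm S ℕ []} :
      Entails (insert A H) B → Entails H (.imp A B)
  | impE {H : Set (OForm S ℕ [])} {A B : OForm S ℕ []} :
      Entails H (.imp A B) → Entails H A → Entails H B
  | allI {H : Set (OForm S ℕ [])} {τ : Ty S.Ground} {B : OForm S ℕ [τ]} (y : ℕ) :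
      (∀ F ∈ H, ¬ F.Occurs τ y) → ¬ B.Occurs τ y →
      Entails H (B.inst (.free τ y)) → Entails H (.all τ B)
  | allE {H : Set (OForm S ℕ [])} {τ : Ty S.Ground} {B : OForm S ℕ [τ]} (t : Tm S ℕ [] τ) :
      Entails H (.all τ B) → Entails H (B.inst t)
  | exI {H : Set (OForm S ℕ [])} {τ : Ty S.Ground} {B : OForm S ℕ [τ]} (t : Tm S ℕ [] τ) :
      Entails H (B.inst t) → Entails H (.ex τ B)
  | exE {H : Set (OForm S ℕ [])} {τ : Ty S.Ground} {B : OForm S ℕ [τ]} {C : OForm S ℕ []}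
      (y : ℕ) :
      (∀ F ∈ H, ¬ F.Occurs τ y) → ¬ B.Occurs τ y → ¬ C.Occurs τ y →
      Entails H (.ex τ B) → Entails (insert (B.inst (.free τ y)) H) C → Entails H C

/-- `Translates B φ`: the term `B` of type `prp` translates to the formula `φ` of
intuitionistic logic. Terms are taken up to `βη`-conversion. -/
inductive Translates : {Γ : List (Ty S.Ground)} → Tm S N Γ .prp → OForm S N Γ → Prop
  | atom {Γ : List (Ty S.Ground)} (a : Tm S N Γ .atm) : Translates (atomT a) (OForm.atm a)
  | tt {Γ : List (Ty S.Ground)} : Translates (ttT (Γ := Γ)) .top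
  | and {Γ : List (Ty S.Ground)} {b c : Tm S N Γ .prp} {φ ψ : OForm S N Γ} :
      Translates b φ → Translates c ψ → Translates (andT b c) (.and φ ψ)
  | imp {Γ : List (Ty S.Ground)} (a : Tm S N Γ .atm) {b : Tm S N Γ .prp} {φ : OForm S N Γ} :
      Translates b φ → Translates (impT a b) (.imp (OForm.atm a) φ)
  | all {Γ : List (Ty S.Ground)} {b : Tm S N (.i :: Γ) .prp} {φ : OForm S N (.i :: Γ)} :
      Translates b φ → Translates (allT (.lam b)) (.all .i φ)
  | conv {Γ : List (Ty S.Ground)} {b b' : Tm S N Γ .prp} {φ : OForm S N Γ} :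
      b.Conv b' → Translates b φ → Translates b' φ

/-- `TranslatesList L M`: the term `L` of type `atmlst` translates to the multiset `M` of atomic
formulas. -/
inductive TranslatesList : Tm S N [] .atmlst → Multiset (OForm S N []) → Prop
  | nil : TranslatesList nilT 0
  | cons (a : Tm S N [] .atm) {l : Tm S N [] .atmlst} {M : Multiset (OForm S N [])} :
      TranslatesList l M → TranslatesList (consT a l) (OForm.atm a ::ₘ M)
  | conv {l l' : Tm S N [] .atmlst} {M : Multiset (OForm S N [])} :
      l.Conv l' → TranslatesList l M → TranslatesList l' M

/-- One clause of an object-level theory: the terms `A` and `G` (over the clause variables, whose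
types are listed in `ctx`) and the translation of `G`. -/
structure ProgClause (S : Signature.{u}) where
  ctx : List (Ty S.Ground)
  A : Tm S Empty ctx .atm
  G : Tm S Empty ctx .prp
  transG : OForm S Empty ctx
  translates : Translates G transG

/-- The definitional clause `∀ x̄ [prog A G ≜ ⊤]`. -/
def ProgClause.toClause (c : ProgClause S) : Clause S :=
  ⟨c.ctx, .prog, .cons c.A (.cons c.G .nil), .top⟩

/-- The formula `⋀ x̄ (G ⇒ A)` of intuitionistic logic. -/
def ProgClause.toForm (c : ProgClause S) : OForm S ℕ [] :=
  (Form.close c.ctx (.imp c.transG (OForm.atm c.A))).ofClosed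

/-- The definition of `prog`. -/
def defProg (T : List (ProgClause S)) : Set (Clause S) :=
  {d | ∃ c ∈ T, d = c.toClause}

/-- The corresponding theory in intuitionistic logic. -/
def theory (T : List (ProgClause S)) : Set (OForm S ℕ []) :=
  {F | ∃ c ∈ T, F = c.toForm}

end ObjectLogic

end FOLambda

/-!
The two notions of provability are linked in a cycle through goal-directed proofs.

From the meta-logic to the object logic: since the level of a clause body does not exceed that of
its head, and only the left of an implication raises the level, the definition has a two-valued
model, built level by level as least fixed points, in which `nat` holds of the numerals only. The
carrier of the model is the terms modulo conversion, where constructors are injective and disjoint: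
evaluate terms in the full type structure over trees that record head constructors. Derivable
sequents are valid in the model, so `prv L B` yields a numeral `n` such that `seq n L B` is true,
and induction on `n` turns this into a proof in the object logic.

From the object logic to goal-directed proofs: lists of atoms, ordered by inclusion, are the worlds
of a Kripke structure with all open terms as a constant domain, where an atom is forced when it has
a goal-directed proof. Every formula in the range of the translation that is forced has a
goal-directed proof. For `⋀` it is enough to have one for a fresh variable; substituting for the
variable keeps the height, hence a single bound on the height serves all instances.

Goal-directed proofs of height `n` are, rule by rule, derivations of `seq n L B`.
-/

namespace FOLambda

/-! ## Substitution -/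

section Substitution
variable {S : Signature.{u}} {N N' N'' : Type} {Γ Δ Θ τs : List (Ty S.Ground)} {σ τ : Ty S.Ground}

/-- The extension of an assignment that sends index `0` to `t` and index `x + 1` to `η x`; the
instances of the matrix of a quantifier are taken along such extensions. -/
def Assign.cons (t : Tm S N Δ σ) (η : Assign S N Γ Δ) : Assign S N (σ :: Γ) Δ
  | _, .zero => t
  | _, .succ x => η _ x

theorem Assign.single_eq_cons (t : Tm S N Γ σ) :
    Assign.single t = Assign.cons t fun _ => .bvar := by
  funext _ x; cases x <;> rfl

theorem Assign.eq_none (η : Assign S N [] Δ) : η = Assign.none := by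
  funext _ x; cases x

theorem Assign.cons_head_tail (η : Assign S N (σ :: Γ) Δ) :
    Assign.cons (η _ .zero) (fun τ x => η τ (.succ x)) = η := by
  funext _ x; cases x <;> rfl

theorem Assign.lift_bvar (σ : Ty S.Ground) :
    Assign.lift (fun _ => .bvar : Assign S N Γ Γ) σ = fun _ => .bvar := by
  funext _ x; cases x <;> rfl

theorem Var.lift_comp {T : Type u} {Γ Δ Θ : List T} (ρ : ∀ τ : T, Var Γ τ → Var Δ τ)
    (ρ' : ∀ τ : T, Var Δ τ → Var Θ τ) (σ : T) :
    (fun τ x => Var.lift ρ' σ τ (Var.lift ρ σ τ x)) = Var.lift (fun τ x => ρ' τ (ρ τ x)) σ := by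
  funext _ x; cases x <;> rfl

namespace Tm

theorem rename_rename (t : Tm S N Γ τ) (ρ : ∀ τ, Var Γ τ → Var Δ τ) (ρ' : ∀ τ, Var Δ τ → Var Θ τ) :
    (t.rename ρ).rename ρ' = t.rename fun τ x => ρ' τ (ρ τ x) := by
  induction t generalizing Δ Θ with
  | bvar | free | const => rfl
  | app t t' ih ih' => simp only [rename, ih, ih']
  | lam t ih => simp only [rename, ih, Var.lift_comp]

theorem wk_rename_lift (t : Tm S N Γ τ) (ρ : ∀ τ, Var Γ τ → Var Δ τ) :
    t.wk.rename (Var.lift ρ σ) = (t.rename ρ).wk := by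
  simp only [wk, rename_rename]; rfl

theorem rename_bind (t : Tm S N Γ τ) (ρ : ∀ τ, Var Γ τ → Var Δ τ) (θ : NameSubst S N N' Θ)
    (η : Assign S N' Δ Θ) : (t.rename ρ).bind θ η = t.bind θ fun τ x => η τ (ρ τ x) := by
  induction t generalizing Δ Θ with
  | bvar | free | const => rfl
  | app t t' ih ih' => simp only [rename, bind, ih, ih']
  | lam t ih =>
    simp only [rename, bind, ih]
    congr 2
    funext _ x; cases x <;> rfl

theorem wk_bind_cons (t : Tm S N Γ τ) (θ : NameSubst S N N' Θ) (r : Tm S N' Θ σ)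
    (η : Assign S N' Γ Θ) : t.wk.bind θ (Assign.cons r η) = t.bind θ η :=
  t.rename_bind _ θ _

theorem bind_rename (t : Tm S N Γ τ) (θ : NameSubst S N N' Δ) (η : Assign S N' Γ Δ)
    (ρ : ∀ τ, Var Δ τ → Var Θ τ) :
    (t.bind θ η).rename ρ =
      t.bind (fun τ n => (θ τ n).rename ρ) fun τ x => (η τ x).rename ρ := by
  induction t generalizing Δ Θ with
  | bvar | free | const => rfl
  | app t t' ih ih' => simp only [rename, bind, ih, ih']
  | lam t ih =>
    simp only [rename, bind, ih]
    congr 2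
    · funext _ _; exact wk_rename_lift _ _
    · funext _ x; cases x
      · rfl
      · exact wk_rename_lift _ _

theorem wk_bind_lift (t : Tm S N Γ τ) (θ : NameSubst S N N' Δ) (η : Assign S N' Γ Δ) :
    t.wk.bind (θ.wk σ) (η.lift σ) = (t.bind θ η).wk := by
  rw [wk, rename_bind, wk, bind_rename]; rfl

end Tm

theorem NameSubst.wk_bind_lift (θ : NameSubst S N N' Δ) (θ' : NameSubst S N' N'' Θ)
    (η' : Assign S N'' Δ Θ) :
    (fun τ n => (θ.wk σ τ n).bind (θ'.wk σ) (η'.lift σ)) =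
      NameSubst.wk (fun τ n => (θ τ n).bind θ' η') σ := by
  funext _ _; exact Tm.wk_bind_lift _ _ _

theorem Assign.lift_bind_lift (η : Assign S N Γ Δ) (θ : NameSubst S N N' Θ)
    (η' : Assign S N' Δ Θ) :
    (fun τ x => (η.lift σ τ x).bind (θ.wk σ) (η'.lift σ)) =
      Assign.lift (fun τ x => (η τ x).bind θ η') σ := by
  funext _ x; cases x
  · rfl
  · exact Tm.wk_bind_lift _ _ _

namespace Tm

theorem bind_bind (t : Tm S N Γ τ) (θ : NameSubst S N N' Δ) (η : Assign S N' Γ Δ)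
    (θ' : NameSubst S N' N'' Θ) (η' : Assign S N'' Δ Θ) :
    (t.bind θ η).bind θ' η' =
      t.bind (fun τ n => (θ τ n).bind θ' η') fun τ x => (η τ x).bind θ' η' := by
  induction t generalizing Δ Θ with
  | bvar | free | const => rfl
  | app t t' ih ih' => simp only [bind, ih, ih']
  | lam t ih => simp only [bind, ih, NameSubst.wk_bind_lift, Assign.lift_bind_lift]

theorem bind_id (t : Tm S N Γ τ) : t.bind .free (fun _ => .bvar) = t := by
  induction t with
  | bvar | free | const => rfl
  | app t t' ih ih' => simp only [bind, ih, ih']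
  | lam t ih =>
    simp only [bind, Assign.lift_bvar]
    exact congrArg lam ih

theorem bind_id_none (t : Tm S N [] τ) : t.bind .free Assign.none = t := by
  rw [← Assign.eq_none fun _ => .bvar, bind_id]

theorem wk_inst (t : Tm S N Γ τ) (r : Tm S N Γ σ) : t.wk.inst r = t := by
  rw [inst, Assign.single_eq_cons, wk_bind_cons, bind_id]

theorem wk_eq_bind (t : Tm S N Γ τ) : t.wk (σ := σ) = t.bind .free fun _ x => .bvar x.succ := by
  conv_lhs => rw [← t.bind_id]
  rw [wk, bind_rename]; rfl

theorem inst_bind (t : Tm S N (σ :: Γ) τ) (r : Tm S N Γ σ) (θ : NameSubst S N N' Δ)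
    (η : Assign S N' Γ Δ) : (t.inst r).bind θ η = t.bind θ (Assign.cons (r.bind θ η) η) := by
  rw [inst, bind_bind]
  congr 1
  funext _ x; cases x <;> rfl

end Tm

theorem NameSubst.wk_bind_cons (θ : NameSubst S N N' Δ) (θ' : NameSubst S N' N'' Θ)
    (r : Tm S N'' Θ σ) (η' : Assign S N'' Δ Θ) :
    (fun τ n => (θ.wk σ τ n).bind θ' (Assign.cons r η')) = fun τ n => (θ τ n).bind θ' η' := by
  funext _ _; exact Tm.wk_bind_cons _ _ _ _

theorem Assign.lift_bind_cons (η : Assign S N Γ Δ) (θ : NameSubst S N N' Θ) (r : Tm S N' Θ σ)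
    (η' : Assign S N' Δ Θ) :
    (fun τ x => (η.lift σ τ x).bind θ (Assign.cons r η')) =
      Assign.cons r fun τ x => (η τ x).bind θ η' := by
  funext _ x; cases x
  · rfl
  · exact Tm.wk_bind_cons _ _ _ _

namespace Tm

theorem bind_lift_inst (t : Tm S N (σ :: Γ) τ) (θ : NameSubst S N N' Δ) (η : Assign S N' Γ Δ)
    (r : Tm S N' Δ σ) : (t.bind (θ.wk σ) (η.lift σ)).inst r = t.bind θ (Assign.cons r η) := by
  rw [inst, Assign.single_eq_cons, bind_bind, NameSubst.wk_bind_cons, Assign.lift_bind_cons]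
  simp only [bind_id]

theorem Conv.bind {t t' : Tm S N Γ τ} (h : t.Conv t') (θ : NameSubst S N N' Δ)
    (η : Assign S N' Γ Δ) : (t.bind θ η).Conv (t'.bind θ η) := by
  induction h generalizing Δ with
  | refl t => exact .refl _
  | symm _ ih => exact (ih θ η).symm
  | trans _ _ ih ih' => exact (ih θ η).trans (ih' θ η)
  | app _ _ ih ih' => exact .app (ih θ η) (ih' θ η)
  | lam _ ih => exact .lam (ih _ _)
  | beta t r =>
    rw [inst_bind, ← bind_lift_inst]
    exact .beta _ _
  | eta t =>
    simp only [Tm.bind, wk_bind_lift]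
    exact .eta _

theorem Conv.wk {t t' : Tm S N Γ τ} (h : t.Conv t') : (t.wk (σ := σ)).Conv t'.wk := by
  rw [wk_eq_bind, wk_eq_bind]
  exact h.bind _ _

theorem bind_conv_bind (t : Tm S N Γ τ) {θ θ' : NameSubst S N N' Δ} {η η' : Assign S N' Γ Δ}
    (hθ : ∀ τ n, (θ τ n).Conv (θ' τ n)) (hη : ∀ τ x, (η τ x).Conv (η' τ x)) :
    (t.bind θ η).Conv (t.bind θ' η') := by
  induction t generalizing Δ with
  | bvar x => exact hη _ x
  | free τ n => exact hθ τ n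
  | const => exact .refl _
  | app t t' ih ih' => exact .app (ih hθ hη) (ih' hθ hη)
  | lam t ih =>
    refine .lam (ih (fun τ n => (hθ τ n).wk) fun τ x => ?_)
    cases x
    · exact .refl _
    · exact (hη _ _).wk

end Tm

namespace Tms

theorem bind_bind (ts : Tms S N Γ τs) (θ : NameSubst S N N' Δ) (η : Assign S N' Γ Δ)
    (θ' : NameSubst S N' N'' Θ) (η' : Assign S N'' Δ Θ) :
    (ts.bind θ η).bind θ' η' =
      ts.bind (fun τ n => (θ τ n).bind θ' η') fun τ x => (η τ x).bind θ' η' := by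
  induction ts with
  | nil => rfl
  | cons t ts ih => simp only [bind, Tm.bind_bind, ih]

theorem Conv.refl (ts : Tms S N Γ τs) : ts.Conv ts := by
  induction ts with
  | nil => exact .nil
  | cons t ts ih => exact .cons (.refl t) ih

theorem Conv.symm {ts ts' : Tms S N Γ τs} (h : ts.Conv ts') : ts'.Conv ts := by
  induction h with
  | nil => exact .nil
  | cons h _ ih => exact .cons h.symm ih

theorem Conv.trans {ts ts' ts'' : Tms S N Γ τs} (h : ts.Conv ts') (h' : ts'.Conv ts'') :
    ts.Conv ts'' := by
  induction h with
  | nil => exact h'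
  | cons h _ ih => cases h' with | cons h₁ h₂ => exact .cons (h.trans h₁) (ih h₂)

theorem Conv.bind {ts ts' : Tms S N Γ τs} (h : ts.Conv ts') (θ : NameSubst S N N' Δ)
    (η : Assign S N' Γ Δ) : (ts.bind θ η).Conv (ts'.bind θ η) := by
  induction h with
  | nil => exact .nil
  | cons h _ ih => exact .cons (h.bind θ η) ih

theorem bind_conv_bind (ts : Tms S N Γ τs) {θ θ' : NameSubst S N N' Δ} {η η' : Assign S N' Γ Δ}
    (hθ : ∀ τ n, (θ τ n).Conv (θ' τ n)) (hη : ∀ τ x, (η τ x).Conv (η' τ x)) :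
    (ts.bind θ η).Conv (ts.bind θ' η') := by
  induction ts with
  | nil => exact .nil
  | cons t ts ih => exact .cons (t.bind_conv_bind hθ hη) ih

end Tms

/-! ## Fresh variables -/

open scoped Classical in
/-- The substitution `θ` changed to `r` at the variable `n` of type `σ`. -/
noncomputable def NameSubst.update (θ : NameSubst S N N' Δ) (σ : Ty S.Ground) (n : N)
    (r : Tm S N' Δ σ) : NameSubst S N N' Δ :=
  Function.update θ σ (Function.update (θ σ) n r)

theorem NameSubst.update_same (θ : NameSubst S N N' Δ) (σ : Ty S.Ground) (n : N)
    (r : Tm S N' Δ σ) : θ.update σ n r σ n = r := by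
  simp only [update, Function.update_self]

theorem NameSubst.update_of_ne (θ : NameSubst S N N' Δ) {m n : N} (r : Tm S N' Δ σ)
    (h : ¬ (τ = σ ∧ m = n)) : θ.update σ n r τ m = θ τ m := by
  classical
  by_cases hτ : τ = σ
  · subst hτ
    have hm : m ≠ n := fun hm => h ⟨rfl, hm⟩
    simp only [update, Function.update_self, Function.update_of_ne hm]
  · simp only [update, Function.update_of_ne hτ]

namespace Tm

theorem bind_congr (t : Tm S N Γ τ) {θ θ' : NameSubst S N N' Δ} {η : Assign S N' Γ Δ}
    (h : ∀ τ n, t.Occurs τ n → θ τ n = θ' τ n) : t.bind θ η = t.bind θ' η := by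
  induction t generalizing Δ with
  | bvar | const => rfl
  | free τ n => exact h τ n ⟨rfl, rfl⟩
  | app t t' ih ih' =>
    simp only [bind, ih fun τ n ho => h τ n (.inl ho), ih' fun τ n ho => h τ n (.inr ho)]
  | lam t ih => exact congrArg lam (ih fun τ n ho => congrArg wk (h τ n ho))

theorem bind_update_of_not_occurs (t : Tm S N Γ τ) {n : N} (h : ¬ t.Occurs σ n)
    (θ : NameSubst S N N' Δ) (r : Tm S N' Δ σ) (η : Assign S N' Γ Δ) :
    t.bind (θ.update σ n r) η = t.bind θ η :=
  t.bind_congr fun _ _ ho => θ.update_of_ne r fun e => h (by rwa [e.1, e.2] at ho)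

theorem eventually_not_occurs (t : Tm S N Γ τ) (σ : Ty S.Ground) :
    ∀ᶠ n in Filter.cofinite, ¬ t.Occurs σ n := by
  induction t with
  | bvar | const => exact .of_forall fun _ => not_false
  | free _ m => exact (Filter.eventually_cofinite_ne m).mono fun _ hn h => hn h.2.symm
  | app _ _ ih ih' => exact (ih.and ih').mono fun _ h => not_or.2 h
  | lam _ ih => exact ih

theorem Conv.ext [Infinite N] {t t' : Tm S N [] (.arr σ τ)}
    (h : ∀ r, (Tm.app t r).Conv (Tm.app t' r)) : t.Conv t' := by
  obtain ⟨n, hn, hn'⟩ := ((t.eventually_not_occurs σ).and (t'.eventually_not_occurs σ)).exists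
  let θ : NameSubst S N N [σ] := NameSubst.update .free σ n (.bvar .zero)
  have bind_eq_wk (r : Tm S N [] (.arr σ τ)) (hr : ¬ r.Occurs σ n) :
      r.bind θ Assign.none = r.wk := by
    rw [bind_update_of_not_occurs r hr, wk_eq_bind, Assign.eq_none fun _ x => .bvar x.succ]
  have conv_at_bvar : (Tm.app t.wk (.bvar .zero)).Conv (Tm.app t'.wk (.bvar .zero)) := by
    simpa only [Tm.bind, bind_eq_wk t hn, bind_eq_wk t' hn', θ, NameSubst.update_same]
      using (h (Tm.free σ n)).bind θ Assign.none
  exact ((Conv.eta t).symm.trans conv_at_bvar.lam).trans (.eta t')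

end Tm

namespace Tms

theorem bind_congr (ts : Tms S N Γ τs) {θ θ' : NameSubst S N N' Δ} {η : Assign S N' Γ Δ}
    (h : ∀ τ n, ts.Occurs τ n → θ τ n = θ' τ n) : ts.bind θ η = ts.bind θ' η := by
  induction ts with
  | nil => rfl
  | cons t ts ih =>
    simp only [bind, t.bind_congr fun τ n ho => h τ n (.inl ho), ih fun τ n ho => h τ n (.inr ho)]

theorem eventually_not_occurs (ts : Tms S N Γ τs) (σ : Ty S.Ground) :
    ∀ᶠ n in Filter.cofinite, ¬ ts.Occurs σ n := by
  induction ts with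
  | nil => exact .of_forall fun _ => not_false
  | cons t ts ih => exact ((t.eventually_not_occurs σ).and ih).mono fun _ h => not_or.2 h

end Tms

end Substitution

/-! ## Injectivity of the constructors modulo conversion -/

section Injectivity
variable {S : Signature.{u}} {N N' : Type} {Γ Δ : List (Ty S.Ground)} {σ τ : Ty S.Ground}

instance : Nonempty (Tm S ℕ [] τ) := ⟨.free τ 0⟩

/-- Convertibility as an equivalence relation. -/
def convSetoid (S : Signature.{u}) (τ : Ty S.Ground) : Setoid (Tm S ℕ [] τ) :=
  ⟨Tm.Conv, .refl, .symm, .trans⟩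

/-- Conversion classes of terms that may contain named variables. -/
def Cls (S : Signature.{u}) (τ : Ty S.Ground) : Type u := Quotient (convSetoid S τ)

/-- The conversion class of a term. -/
def Tm.cls (t : Tm S ℕ [] τ) : Cls S τ := Quotient.mk (convSetoid S τ) t

theorem Tm.cls_eq {t t' : Tm S ℕ [] τ} : t.cls = t'.cls ↔ t.Conv t' :=
  Quotient.eq (r := convSetoid S τ)

/-- The head constructor of a term of ground type with the classes of its arguments, or `neutral`
for a term headed by a variable or by a constant of the signature. -/
inductive HeadShape (S : Signature.{u}) : Type u
  | neutral
  | zero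
  | suc (n : Cls S .nt)
  | nil
  | cons (a : Cls S .atm) (l : Cls S .atmlst)
  | atom (a : Cls S .atm)
  | tt
  | and (b c : Cls S .prp)
  | imp (a : Cls S .atm) (b : Cls S .prp)
  | all (b : Cls S (.arr .i .prp))

/-- The full type structure in which terms are evaluated. An element of ground type is a
conversion class together with a head shape; the two components need not match. -/
def Dom (S : Signature.{u}) : Ty S.Ground → Type u
  | .base b => Cls S (.base b) × HeadShape S
  | .arr σ τ => Dom S σ → Dom S τ

/-- The logical relation between elements of the type structure and terms, which says that the
element `a` represents the term `t`. -/
def Represents : (τ : Ty S.Ground) → Dom S τ → Tm S ℕ [] τ → Prop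
  | .base _, a, t => a.1 = t.cls
  | .arr σ τ, f, t => ∀ a s, Represents σ a s → Represents τ (f a) (.app t s)

theorem Represents.conv {a : Dom S τ} {t t' : Tm S ℕ [] τ} (h : Represents τ a t)
    (ht : t.Conv t') : Represents τ a t' := by
  induction τ with
  | base b => exact Eq.trans h (Tm.cls_eq.2 ht)
  | arr σ τ _ ih => exact fun b s hs => ih (h b s hs) (ht.app (.refl s))

theorem represents_total_and_functional (τ : Ty S.Ground) :
    (∀ t, ∃ a, Represents τ a t) ∧
      ∀ a t t', Represents τ a t → Represents τ a t' → t.Conv t' := by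
  induction τ with
  | base b =>
    exact ⟨fun t => ⟨(t.cls, .neutral), rfl⟩,
      fun a t t' h h' => Tm.cls_eq.1 (Eq.trans (Eq.symm h) h')⟩
  | arr σ τ ihσ ihτ =>
    constructor
    · intro t
      choose reflectτ represents_reflectτ using ihτ.1
      refine ⟨fun a => reflectτ (.app t (Classical.epsilon (Represents σ a))), fun a s hs => ?_⟩
      exact (represents_reflectτ _).conv
        (.app (.refl t) (ihσ.2 a _ _ (Classical.epsilon_spec ⟨s, hs⟩) hs))
    · intro f t t' h h'
      refine Tm.Conv.ext fun r => ?_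
      obtain ⟨a, ha⟩ := ihσ.1 r
      exact ihτ.2 _ _ _ (h a r ha) (h' a r ha)

/-- Some element that represents a given term. -/
noncomputable def reflect (t : Tm S ℕ [] τ) : Dom S τ :=
  ((represents_total_and_functional τ).1 t).choose

theorem represents_reflect (t : Tm S ℕ [] τ) : Represents τ (reflect t) t :=
  ((represents_total_and_functional τ).1 t).choose_spec

/-- A term represented by a given element; arbitrary if there is none. -/
noncomputable def reify (a : Dom S τ) : Tm S ℕ [] τ :=
  Classical.epsilon (Represents τ a)

theorem Represents.reify_conv {a : Dom S τ} {t : Tm S ℕ [] τ} (h : Represents τ a t) :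
    (reify a).Conv t :=
  (represents_total_and_functional τ).2 _ _ _ (Classical.epsilon_spec ⟨t, h⟩) h

/-- The interpretation of the constants. The constructors of the encoding record their head shape,
the other constants are interpreted by representatives. -/
noncomputable def Const.eval : {τ : Ty S.Ground} → Const S τ → Dom S τ
  | _, .zero => ((zeroT : Tm S ℕ [] .nt).cls, .zero)
  | _, .suc => fun n => ((sucT (reify n)).cls, .suc (reify n).cls)
  | _, .nil => ((nilT : Tm S ℕ [] .atmlst).cls, .nil)
  | _, .cons => fun a l => ((consT (reify a) (reify l)).cls, .cons (reify a).cls (reify l).cls)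
  | _, .atom => fun a => ((atomT (reify a)).cls, .atom (reify a).cls)
  | _, .tt => ((ttT : Tm S ℕ [] .prp).cls, .tt)
  | _, .and => fun b c => ((andT (reify b) (reify c)).cls, .and (reify b).cls (reify c).cls)
  | _, .imp => fun a b => ((impT (reify a) (reify b)).cls, .imp (reify a).cls (reify b).cls)
  | _, .all => fun b => ((allT (reify b)).cls, .all (reify b).cls)
  | _, .other c => reflect (.const (.other c))

theorem Const.represents_eval (c : Const S τ) : Represents τ c.eval (.const c) := by
  cases c with
  | zero | nil | tt => exact rfl
  | suc | atom | all => exact fun a s h => Tm.cls_eq.2 (.app (.refl _) h.reify_conv)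
  | cons | and | imp =>
    exact fun a s h a' s' h' => Tm.cls_eq.2 (.app (.app (.refl _) h.reify_conv) h'.reify_conv)
  | other c => exact represents_reflect _

/-- Valuations of the indices of a context in the type structure. -/
abbrev Valuation (S : Signature.{u}) (Γ : List (Ty S.Ground)) : Type u :=
  ∀ τ : Ty S.Ground, Var Γ τ → Dom S τ

/-- The extension of a valuation that sends index `0` to `a` and index `x + 1` to `ρ x`. -/
def Valuation.cons (a : Dom S σ) (ρ : Valuation S Γ) : Valuation S (σ :: Γ)
  | _, .zero => a
  | _, .succ x => ρ _ x

namespace Tm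

/-- The value of a term, given the values `ν` of the named variables and `ρ` of the indices. -/
noncomputable def eval (ν : ∀ τ : Ty S.Ground, N → Dom S τ) {Γ : List (Ty S.Ground)}
    {τ : Ty S.Ground} : Tm S N Γ τ → Valuation S Γ → Dom S τ
  | .bvar x, ρ => ρ _ x
  | .free τ n, _ => ν τ n
  | .const c, _ => c.eval
  | .app t t', ρ => (t.eval ν ρ) (t'.eval ν ρ)
  | .lam t, ρ => fun a => t.eval ν (ρ.cons a)

theorem eval_rename (t : Tm S N Γ τ) (r : ∀ τ, Var Γ τ → Var Δ τ)
    (ν : ∀ τ : Ty S.Ground, N → Dom S τ) (ρ : Valuation S Δ) :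
    (t.rename r).eval ν ρ = t.eval ν fun τ x => ρ τ (r τ x) := by
  induction t generalizing Δ with
  | bvar | free | const => rfl
  | app t t' ih ih' => simp only [rename, eval, ih, ih']
  | lam t ih =>
    simp only [rename, eval, ih]
    funext _
    congr 1
    funext _ x; cases x <;> rfl

theorem eval_bind (t : Tm S N Γ τ) (θ : NameSubst S N N' Δ) (η : Assign S N' Γ Δ)
    (ν : ∀ τ : Ty S.Ground, N' → Dom S τ) (ρ : Valuation S Δ) :
    (t.bind θ η).eval ν ρ =
      t.eval (fun τ n => (θ τ n).eval ν ρ) fun τ x => (η τ x).eval ν ρ := by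
  induction t generalizing Δ with
  | bvar | free | const => rfl
  | app t t' ih ih' => simp only [bind, eval, ih, ih']
  | lam t ih =>
    simp only [bind, eval, ih]
    funext _
    congr 1
    · funext _ _; exact eval_rename _ _ _ _
    · funext _ x; cases x
      · rfl
      · exact eval_rename _ _ _ _

theorem Conv.eval_eq {t t' : Tm S N Γ τ} (h : t.Conv t') (ν : ∀ τ : Ty S.Ground, N → Dom S τ)
    (ρ : Valuation S Γ) : t.eval ν ρ = t'.eval ν ρ := by
  induction h with
  | refl t => rfl
  | symm _ ih => exact (ih ρ).symm
  | trans _ _ ih ih' => exact (ih ρ).trans (ih' ρ)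
  | app _ _ ih ih' => simp only [eval, ih, ih']
  | lam _ ih => exact funext fun a => ih _
  | beta t r =>
    rw [inst, eval_bind]
    simp only [eval]
    congr 1
    funext _ x; cases x <;> rfl
  | eta t =>
    simp only [eval, Tm.wk, eval_rename]
    rfl

theorem represents_eval (t : Tm S N Γ τ) {ν : ∀ τ : Ty S.Ground, N → Dom S τ}
    {θ : NameSubst S N ℕ []} {ρ : Valuation S Γ} {η : Assign S ℕ Γ []}
    (hν : ∀ τ n, Represents τ (ν τ n) (θ τ n)) (hρ : ∀ τ x, Represents τ (ρ τ x) (η τ x)) :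
    Represents τ (t.eval ν ρ) (t.bind θ η) := by
  induction t with
  | bvar x => exact hρ _ x
  | free τ n => exact hν τ n
  | const c => exact c.represents_eval
  | app _ _ ih ih' => exact ih hρ _ _ (ih' hρ)
  | lam _ ih =>
    intro a s hs
    have represents_matrix := ih (ρ := ρ.cons a) (η := Assign.cons s η) fun τ x => by
      cases x
      · exact hs
      · exact hρ _ _
    rw [← bind_lift_inst] at represents_matrix
    exact represents_matrix.conv (Conv.beta _ _).symm

/-- The value of a term under the valuation that reflects the named variables. -/
noncomputable def value (t : Tm S ℕ [] τ) : Dom S τ :=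
  t.eval (fun τ n => reflect (.free τ n)) fun _ x => nomatch x

theorem reify_value_conv (t : Tm S ℕ [] τ) : (reify t.value).Conv t := by
  have h := t.represents_eval (fun τ n => represents_reflect (.free τ n))
    (ρ := fun _ x => nomatch x) (η := Assign.none) fun _ x => nomatch x
  rw [bind_id_none] at h
  exact h.reify_conv

theorem cls_reify_value (t : Tm S ℕ [] τ) : (reify t.value).cls = t.cls :=
  cls_eq.2 t.reify_value_conv

/-- The head constructor of a term of ground type and the classes of its arguments. -/
noncomputable def shape {b : Base S.Ground} (t : Tm S ℕ [] (.base b)) : HeadShape S :=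
  Prod.snd (α := Cls S (.base b)) t.value

theorem Conv.shape_eq {b : Base S.Ground} {t t' : Tm S ℕ [] (.base b)} (h : t.Conv t') :
    t.shape = t'.shape :=
  congrArg (Prod.snd (α := Cls S (.base b))) (h.eval_eq _ _)

end Tm

theorem shape_sucT (n : Tm S ℕ [] .nt) : (sucT n).shape = .suc n.cls :=
  congrArg HeadShape.suc n.cls_reify_value

theorem shape_consT (a : Tm S ℕ [] .atm) (l : Tm S ℕ [] .atmlst) :
    (consT a l).shape = .cons a.cls l.cls :=
  congrArg₂ HeadShape.cons a.cls_reify_value l.cls_reify_value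

theorem shape_atomT (a : Tm S ℕ [] .atm) : (atomT a).shape = .atom a.cls :=
  congrArg HeadShape.atom a.cls_reify_value

theorem shape_andT (b c : Tm S ℕ [] .prp) : (andT b c).shape = .and b.cls c.cls :=
  congrArg₂ HeadShape.and b.cls_reify_value c.cls_reify_value

theorem shape_impT (a : Tm S ℕ [] .atm) (b : Tm S ℕ [] .prp) :
    (impT a b).shape = .imp a.cls b.cls :=
  congrArg₂ HeadShape.imp a.cls_reify_value b.cls_reify_value

theorem shape_allT (b : Tm S ℕ [] (.arr .i .prp)) : (allT b).shape = .all b.cls :=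
  congrArg HeadShape.all b.cls_reify_value

theorem sucT_conv_inj {m n : Tm S ℕ [] .nt} (h : (sucT m).Conv (sucT n)) : m.Conv n := by
  simpa only [shape_sucT, HeadShape.suc.injEq, Tm.cls_eq] using h.shape_eq

theorem consT_conv_inj {a a' : Tm S ℕ [] .atm} {l l' : Tm S ℕ [] .atmlst}
    (h : (consT a l).Conv (consT a' l')) : a.Conv a' ∧ l.Conv l' := by
  simpa only [shape_consT, HeadShape.cons.injEq, Tm.cls_eq] using h.shape_eq

theorem atomT_conv_inj {a a' : Tm S ℕ [] .atm} (h : (atomT a).Conv (atomT a')) : a.Conv a' := by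
  simpa only [shape_atomT, HeadShape.atom.injEq, Tm.cls_eq] using h.shape_eq

theorem andT_conv_inj {b b' c c' : Tm S ℕ [] .prp} (h : (andT b c).Conv (andT b' c')) :
    b.Conv b' ∧ c.Conv c' := by
  simpa only [shape_andT, HeadShape.and.injEq, Tm.cls_eq] using h.shape_eq

theorem impT_conv_inj {a a' : Tm S ℕ [] .atm} {b b' : Tm S ℕ [] .prp}
    (h : (impT a b).Conv (impT a' b')) : a.Conv a' ∧ b.Conv b' := by
  simpa only [shape_impT, HeadShape.imp.injEq, Tm.cls_eq] using h.shape_eq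

theorem allT_conv_inj {b b' : Tm S ℕ [] (.arr .i .prp)} (h : (allT b).Conv (allT b')) :
    b.Conv b' := by
  simpa only [shape_allT, HeadShape.all.injEq, Tm.cls_eq] using h.shape_eq

end Injectivity

/-! ## Formulas -/

namespace Form

section
variable {S : Signature.{u}} {P : Type u} {ar : P → List (Ty S.Ground)} {N N' N'' : Type}
  {Γ Δ Θ : List (Ty S.Ground)} {σ : Ty S.Ground}

theorem bind_bind (B : Form S ar N Γ) (θ : NameSubst S N N' Δ) (η : Assign S N' Γ Δ)
    (θ' : NameSubst S N' N'' Θ) (η' : Assign S N'' Δ Θ) :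
    (B.bind θ η).bind θ' η' =
      B.bind (fun τ n => (θ τ n).bind θ' η') fun τ x => (η τ x).bind θ' η' := by
  induction B generalizing Δ Θ with
  | atom p ts => simp only [bind, Tms.bind_bind]
  | top | bot => rfl
  | and _ _ ih ih' | or _ _ ih ih' | imp _ _ ih ih' => simp only [bind, ih, ih']
  | all τ _ ih | ex τ _ ih =>
    simp only [bind, ih, NameSubst.wk_bind_lift, Assign.lift_bind_lift]

theorem bind_lift_inst (B : Form S ar N (σ :: Γ)) (θ : NameSubst S N N' Δ) (η : Assign S N' Γ Δ)
    (r : Tm S N' Δ σ) : (B.bind (θ.wk σ) (η.lift σ)).inst r = B.bind θ (Assign.cons r η) := by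
  rw [inst, Assign.single_eq_cons, bind_bind, NameSubst.wk_bind_cons, Assign.lift_bind_cons]
  simp only [Tm.bind_id]

theorem eventually_not_occurs (B : Form S ar N Γ) (σ : Ty S.Ground) :
    ∀ᶠ n in Filter.cofinite, ¬ B.Occurs σ n := by
  induction B with
  | atom p ts => exact ts.eventually_not_occurs σ
  | top | bot => exact .of_forall fun _ => not_false
  | and _ _ ih ih' | or _ _ ih ih' | imp _ _ ih ih' =>
    exact (ih.and ih').mono fun _ h => not_or.2 h
  | all _ _ ih | ex _ _ ih => exact ih

namespace Conv

theorem refl (B : Form S ar N Γ) : B.Conv B := by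
  induction B with
  | atom p ts => exact .atom p (.refl ts)
  | top => exact .top
  | bot => exact .bot
  | and _ _ ih ih' => exact .and ih ih'
  | or _ _ ih ih' => exact .or ih ih'
  | imp _ _ ih ih' => exact .imp ih ih'
  | all τ _ ih => exact .all τ ih
  | ex τ _ ih => exact .ex τ ih

theorem bind {B C : Form S ar N Γ} (h : B.Conv C) (θ : NameSubst S N N' Δ)
    (η : Assign S N' Γ Δ) : (B.bind θ η).Conv (C.bind θ η) := by
  induction h generalizing Δ with
  | atom p h => exact .atom p (h.bind θ η)
  | top => exact .top
  | bot => exact .bot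
  | and _ _ ih ih' => exact .and (ih θ η) (ih' θ η)
  | or _ _ ih ih' => exact .or (ih θ η) (ih' θ η)
  | imp _ _ ih ih' => exact .imp (ih θ η) (ih' θ η)
  | all τ _ ih => exact .all τ (ih _ _)
  | ex τ _ ih => exact .ex τ (ih _ _)

theorem trans {B C E : Form S ar N Γ} (h : B.Conv C) (h' : C.Conv E) : B.Conv E := by
  induction h with
  | atom p h => cases h' with | atom _ h' => exact .atom p (h.trans h')
  | top | bot => exact h'
  | and _ _ ih ih' => cases h' with | and h h' => exact .and (ih h) (ih' h')
  | or _ _ ih ih' => cases h' with | or h h' => exact .or (ih h) (ih' h')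
  | imp _ _ ih ih' => cases h' with | imp h h' => exact .imp (ih h) (ih' h')
  | all τ _ ih => cases h' with | all _ h => exact .all τ (ih h)
  | ex τ _ ih => cases h' with | ex _ h => exact .ex τ (ih h)

end Conv

end

end Form

/-! ## Kripke forcing over the domain of open terms -/

/-- Interpretations of the predicate symbols over the terms that may contain named variables. -/
abbrev Interp (S : Signature.{u}) {P : Type u} (ar : P → List (Ty S.Ground)) : Type u :=
  ∀ p : P, Tms S ℕ [] (ar p) → Prop

section
variable {S : Signature.{u}} {P : Type u} {ar : P → List (Ty S.Ground)} {N N' : Type}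
  {Γ Δ : List (Ty S.Ground)} {σ : Ty S.Ground}

/-- Interpretations that respect `βη`-conversion. -/
def ConvInvariant (I : Interp S ar) : Prop :=
  ∀ (p : P) (ts us : Tms S ℕ [] (ar p)), ts.Conv us → I p ts → I p us

theorem Assign.cons_conv {t t' : Tm S N Δ σ} (ht : t.Conv t') {η η' : Assign S N Γ Δ}
    (hη : ∀ τ x, (η τ x).Conv (η' τ x)) (τ : Ty S.Ground) (x : Var (σ :: Γ) τ) :
    (Assign.cons t η τ x).Conv (Assign.cons t' η' τ x) := by
  cases x
  · exact ht
  · exact hη _ _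

namespace Form
variable {W : Type*} [Preorder W]

/-- Forcing in a Kripke structure with worlds `W`, whose constant domain at type `τ` consists of
the terms of type `τ`. -/
def Forces (I : W → Interp S ar) {Γ : List (Ty S.Ground)} :
    Form S ar N Γ → NameSubst S N ℕ [] → Assign S ℕ Γ [] → W → Prop
  | .atom p ts, θ, η, w => I w p (ts.bind θ η)
  | .top, _, _, _ => True
  | .bot, _, _, _ => False
  | .and B C, θ, η, w => B.Forces I θ η w ∧ C.Forces I θ η w
  | .or B C, θ, η, w => B.Forces I θ η w ∨ C.Forces I θ η w
  | .imp B C, θ, η, w => ∀ w', w ≤ w' → B.Forces I θ η w' → C.Forces I θ η w'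
  | .all _ B, θ, η, w => ∀ t, B.Forces I θ (Assign.cons t η) w
  | .ex _ B, θ, η, w => ∃ t, B.Forces I θ (Assign.cons t η) w

variable {I : W → Interp S ar}

theorem Forces.mono (hI : Monotone I) {B : Form S ar N Γ} {θ : NameSubst S N ℕ []}
    {η : Assign S ℕ Γ []} {w w' : W} (hw : w ≤ w') (h : B.Forces I θ η w) :
    B.Forces I θ η w' := by
  induction B with
  | atom p ts => exact hI hw p _ h
  | top | bot => exact h
  | and _ _ ih ih' => exact ⟨ih h.1, ih' h.2⟩
  | or _ _ ih ih' => exact h.imp ih ih'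
  | imp => exact fun w'' hw' => h w'' (hw.trans hw')
  | all τ _ ih => exact fun t => ih (h t)
  | ex τ _ ih => exact h.imp fun _ => ih

theorem forces_bind (B : Form S ar N Γ) (θ : NameSubst S N N' Δ) (η : Assign S N' Γ Δ)
    (θ' : NameSubst S N' ℕ []) (η' : Assign S ℕ Δ []) (w : W) :
    (B.bind θ η).Forces I θ' η' w ↔
      B.Forces I (fun τ n => (θ τ n).bind θ' η') (fun τ x => (η τ x).bind θ' η') w := by
  induction B generalizing Δ w with
  | atom p ts => simp only [bind, Forces, Tms.bind_bind]
  | top | bot => rfl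
  | and _ _ ih ih' | or _ _ ih ih' | imp _ _ ih ih' => simp only [bind, Forces, ih, ih']
  | all τ _ ih | ex τ _ ih =>
    simp only [bind, Forces, ih, NameSubst.wk_bind_cons, Assign.lift_bind_cons]

theorem forces_inst (B : Form S ar ℕ (σ :: Γ)) (t : Tm S ℕ Γ σ) (θ : NameSubst S ℕ ℕ [])
    (η : Assign S ℕ Γ []) (w : W) :
    (B.inst t).Forces I θ η w ↔ B.Forces I θ (Assign.cons (t.bind θ η) η) w := by
  rw [inst, forces_bind]
  refine iff_of_eq (congrArg (fun η' => B.Forces I θ η' w) ?_)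
  funext τ x; cases x <;> rfl

theorem forces_congr {B : Form S ar N Γ} {θ θ' : NameSubst S N ℕ []}
    (h : ∀ τ n, B.Occurs τ n → θ τ n = θ' τ n) {η : Assign S ℕ Γ []} {w : W} :
    B.Forces I θ η w ↔ B.Forces I θ' η w := by
  induction B generalizing w with
  | atom p ts => simp only [Forces, ts.bind_congr h]
  | top | bot => rfl
  | and _ _ ih ih' | or _ _ ih ih' | imp _ _ ih ih' =>
    simp only [Forces, ih fun τ n ho => h τ n (.inl ho), ih' fun τ n ho => h τ n (.inr ho)]
  | all τ _ ih | ex τ _ ih => simp only [Forces, ih h]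

theorem forces_update {B : Form S ar N Γ} {n : N} (h : ¬ B.Occurs σ n) (θ : NameSubst S N ℕ [])
    (r : Tm S ℕ [] σ) {η : Assign S ℕ Γ []} {w : W} :
    B.Forces I (θ.update σ n r) η w ↔ B.Forces I θ η w :=
  forces_congr fun _ _ ho => θ.update_of_ne r fun e => h (by rwa [e.1, e.2] at ho)

theorem forces_inst_update {B : Form S ar ℕ [σ]} {n : ℕ} (h : ¬ B.Occurs σ n)
    (θ : NameSubst S ℕ ℕ []) (t : Tm S ℕ [] σ) {w : W} :
    (B.inst (.free σ n)).Forces I (θ.update σ n t) Assign.none w ↔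
      B.Forces I θ (Assign.cons t Assign.none) w := by
  rw [forces_inst, forces_update h, Tm.bind, NameSubst.update_same]

theorem Conv.forces_iff (hI : ∀ w, ConvInvariant (I w)) {B C : Form S ar N Γ} (h : B.Conv C)
    {θ : NameSubst S N ℕ []} {η : Assign S ℕ Γ []} {w : W} :
    B.Forces I θ η w ↔ C.Forces I θ η w := by
  induction h generalizing w with
  | atom p h => exact ⟨hI w _ _ _ (h.bind _ _), hI w _ _ _ (h.symm.bind _ _)⟩
  | top | bot => rfl
  | and _ _ ih ih' | or _ _ ih ih' | imp _ _ ih ih' => simp only [Forces, ih, ih']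
  | all τ _ ih | ex τ _ ih => simp only [Forces, ih]

theorem forces_conv_assign (hI : ∀ w, ConvInvariant (I w)) (B : Form S ar N Γ)
    {θ θ' : NameSubst S N ℕ []} (hθ : ∀ τ n, (θ τ n).Conv (θ' τ n)) {η η' : Assign S ℕ Γ []}
    (hη : ∀ τ x, (η τ x).Conv (η' τ x)) {w : W} :
    B.Forces I θ η w ↔ B.Forces I θ' η' w := by
  induction B generalizing w with
  | atom p ts =>
    exact ⟨hI w _ _ _ (ts.bind_conv_bind hθ hη), hI w _ _ _ (ts.bind_conv_bind hθ hη).symm⟩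
  | top | bot => rfl
  | and _ _ ih ih' => exact and_congr (ih hη) (ih' hη)
  | or _ _ ih ih' => exact or_congr (ih hη) (ih' hη)
  | imp _ _ ih ih' => exact forall₂_congr fun _ _ => imp_congr (ih hη) (ih' hη)
  | all τ _ ih => exact forall_congr' fun t => ih (Assign.cons_conv (.refl t) hη)
  | ex τ _ ih => exact exists_congr fun t => ih (Assign.cons_conv (.refl t) hη)

end Form

end

/-! ## Stratified definitions have a model -/

section Stratification
variable {S : Signature.{u}}

/-- The numeral of `n`, a closed term of type `nt`. -/
def num {N : Type} {Γ : List (Ty S.Ground)} : ℕ → Tm S N Γ .nt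
  | 0 => zeroT
  | n + 1 => sucT (num n)

/-- The substitution for an empty set of names. -/
def NameSubst.empty {N : Type} {Δ : List (Ty S.Ground)} : NameSubst S Empty N Δ :=
  fun _ n => n.elim

theorem NameSubst.eq_empty {N : Type} {Δ : List (Ty S.Ground)} (θ : NameSubst S Empty N Δ) :
    θ = NameSubst.empty := by
  funext _ n; exact n.elim

namespace Form
variable {P : Type u} {ar : P → List (Ty S.Ground)} {N : Type} {Γ : List (Ty S.Ground)}

theorem Conv.pred_eq {p q : P} {ts : Tms S N Γ (ar p)} {us : Tms S N Γ (ar q)}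
    (h : (.atom p ts : Form S ar N Γ).Conv (.atom q us)) : p = q := by
  cases h; rfl

theorem Conv.args {p : P} {ts us : Tms S N Γ (ar p)}
    (h : (.atom p ts : Form S ar N Γ).Conv (.atom p us)) : ts.Conv us := by
  cases h; assumption

/-- Truth in a two-valued structure over the open terms, that is, forcing with a single world. -/
abbrev Holds (I : Interp S ar) (B : Form S ar N Γ) (θ : NameSubst S N ℕ [])
    (η : Assign S ℕ Γ []) : Prop :=
  B.Forces (W := Unit) (fun _ => I) θ η ()

/-- The antecedent of an implication has smaller level than the implication, so the predicates of
top level occur only positively. -/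
theorem Holds.mono_level {lvl : P → ℕ} {n : ℕ} {I J : Interp S ar}
    (hlt : ∀ p, lvl p < n → I p = J p) (hle : ∀ p, lvl p ≤ n → I p ≤ J p) {B : Form S ar N Γ}
    (hB : B.level lvl ≤ n) {θ : NameSubst S N ℕ []} {η : Assign S ℕ Γ []} (h : B.Holds I θ η) :
    B.Holds J θ η := by
  induction B generalizing n I J with
  | atom p ts => exact hle p hB _ h
  | top | bot => exact h
  | and B C ih ih' =>
    exact ⟨ih hlt hle (max_le_iff.1 hB).1 h.1, ih' hlt hle (max_le_iff.1 hB).2 h.2⟩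
  | or B C ih ih' =>
    exact h.imp (ih hlt hle (max_le_iff.1 hB).1) (ih' hlt hle (max_le_iff.1 hB).2)
  | imp B C ih ih' =>
    obtain ⟨hB, hC⟩ := max_le_iff.1 hB
    refine fun w hw hJ => ih' hlt hle hC (h w hw (ih (fun p hp => ?_) (fun p hp => ?_) le_rfl hJ))
    · exact (hlt p (hp.trans hB)).symm
    · exact (hlt p (hp.trans_lt hB)).ge
  | all τ B ih => exact fun t => ih hlt hle hB (h t)
  | ex τ B ih => exact h.imp fun _ => ih hlt hle hB

end Form

/-- One unfolding of the definition `D` and of the generation of the natural numbers. -/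
def definitionStep (D : Set (Clause S)) (I : Interp S (Pred.arity (S := S))) :
    Interp S (Pred.arity (S := S)) :=
  fun p us => (∃ n, (Form.atom p us : MForm S ℕ []).Conv (natF (num n))) ∨
    (p ≠ .nat ∧ ∃ c ∈ D, ∃ η : Assign S ℕ c.ctx [],
      (Form.atom p us : MForm S ℕ []).Conv (Clause.formInst c.head η) ∧
        c.body.Holds I .empty η)

/-- The interpretations in which `nat` is true of the numerals only and every other predicate is
equivalent to the disjunction of its clauses. -/
def IsModel (D : Set (Clause S)) (I : Interp S (Pred.arity (S := S))) : Prop :=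
  definitionStep D I = I

variable {D : Set (Clause S)} {lvl : Pred S → ℕ}

theorem definitionStep_mono_level (hlvl : ∀ c ∈ D, c.body.level lvl ≤ lvl c.pred)
    {I J : Interp S (Pred.arity (S := S))} {p : Pred S} (hlt : ∀ q, lvl q < lvl p → I q = J q)
    (hle : ∀ q, lvl q ≤ lvl p → I q ≤ J q) : definitionStep D I p ≤ definitionStep D J p := by
  refine fun us => Or.imp_right ?_
  rintro ⟨hp, c, hc, η, hη, hB⟩
  have hlvlB : c.body.level lvl ≤ lvl p := (hlvl c hc).trans_eq (congrArg lvl hη.pred_eq).symm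
  exact ⟨hp, c, hc, η, hη, hB.mono_level hlt hle hlvlB⟩

/-- The monotone operator whose least fixed point interprets the predicates of level `n`, when `Y`
interprets the predicates of smaller level. -/
def levelStep (hlvl : ∀ c ∈ D, c.body.level lvl ≤ lvl c.pred) (n : ℕ)
    (Y : Interp S (Pred.arity (S := S))) :
    Interp S (Pred.arity (S := S)) →o Interp S (Pred.arity (S := S)) where
  toFun X p us := lvl p = n ∧ definitionStep D ({q | lvl q < n}.piecewise Y X) p us
  monotone' X X' hX p us := by
    rintro ⟨rfl, h⟩
    refine ⟨rfl, definitionStep_mono_level hlvl (fun q hq => ?_) (fun q _ => ?_) us h⟩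
    · have hq : q ∈ {q | lvl q < lvl p} := hq
      simp only [Set.piecewise_eq_of_mem _ _ _ hq]
    · exact Set.piecewise_mono (fun _ _ => le_rfl) (fun q _ => hX q) q

/-- The interpretation of the predicates of level below `n`. -/
noncomputable def levelModel (hlvl : ∀ c ∈ D, c.body.level lvl ≤ lvl c.pred) :
    ℕ → Interp S (Pred.arity (S := S))
  | 0 => ⊥
  | n + 1 => {p | lvl p < n}.piecewise (levelModel hlvl n)
      (levelStep hlvl n (levelModel hlvl n)).lfp

theorem levelModel_eq_of_lt (hlvl : ∀ c ∈ D, c.body.level lvl ≤ lvl c.pred) {n : ℕ} {p : Pred S}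
    (hp : lvl p < n) : levelModel hlvl n p = levelModel hlvl (lvl p + 1) p := by
  induction n, hp using Nat.le_induction with
  | base => rfl
  | succ n hn ih =>
    have hp : p ∈ {q | lvl q < n} := hn
    rw [levelModel, Set.piecewise_eq_of_mem _ _ _ hp, ih]

theorem levelModel_eq_definitionStep (hlvl : ∀ c ∈ D, c.body.level lvl ≤ lvl c.pred) (p : Pred S) :
    levelModel hlvl (lvl p + 1) p = definitionStep D (levelModel hlvl (lvl p + 1)) p := by
  have hp : p ∉ {q | lvl q < lvl p} := lt_irrefl (lvl p)
  rw [levelModel, Set.piecewise_eq_of_notMem _ _ _ hp]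
  exact (congrFun (OrderHom.map_lfp _) p).symm.trans
    (funext fun _ => propext (and_iff_right rfl))

theorem exists_isModel (hlvl : ∀ c ∈ D, c.body.level lvl ≤ lvl c.pred) :
    ∃ I : Interp S (Pred.arity (S := S)), IsModel D I := by
  let I : Interp S (Pred.arity (S := S)) := fun p => levelModel hlvl (lvl p + 1) p
  refine ⟨I, funext fun p => ?_⟩
  have agree (q : Pred S) (hq : lvl q ≤ lvl p) : I q = levelModel hlvl (lvl p + 1) q :=
    (levelModel_eq_of_lt hlvl (Nat.lt_succ_of_le hq)).symm
  refine .trans (le_antisymm ?_ ?_) (levelModel_eq_definitionStep hlvl p).symm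
  · exact definitionStep_mono_level hlvl (fun q hq => agree q hq.le) fun q hq => (agree q hq).le
  · exact definitionStep_mono_level hlvl (fun q hq => (agree q hq.le).symm)
      fun q hq => (agree q hq).ge

end Stratification

/-! ## Soundness of the meta-logic -/

section Soundness
variable {S : Signature.{u}} {D : Set (Clause S)} {I : Interp S (Pred.arity (S := S))}

namespace Clause
variable {Γ : List (Ty S.Ground)}

theorem formInst_bind (B : MForm S Empty Γ) (η : Assign S ℕ Γ []) (θ : NameSubst S ℕ ℕ []) :
    (formInst B η).bind θ Assign.none = formInst B fun τ x => (η τ x).bind θ Assign.none := by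
  rw [formInst, Form.bind_bind, NameSubst.eq_empty fun τ n => Tm.bind _ _ _, formInst,
    NameSubst.eq_empty fun _ n => n.elim]

theorem holds_formInst (B : MForm S Empty Γ) (η : Assign S ℕ Γ []) (θ : NameSubst S ℕ ℕ []) :
    (formInst B η).Holds I θ Assign.none ↔
      B.Holds I .empty fun τ x => (η τ x).bind θ Assign.none := by
  rw [Form.Holds, formInst, Form.forces_bind, NameSubst.eq_empty fun τ n => _]

end Clause

namespace IsModel

theorem convInvariant (hI : IsModel D I) : ConvInvariant I := by
  intro p us us' h hp
  rw [← hI] at hp ⊢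
  rcases hp with ⟨n, hn⟩ | ⟨hp, c, hc, η, hη, hB⟩
  · exact .inl ⟨n, (Form.Conv.atom p h.symm).trans hn⟩
  · exact .inr ⟨hp, c, hc, η, (Form.Conv.atom p h.symm).trans hη, hB⟩

theorem nat_iff (hI : IsModel D I) (t : Tm S ℕ [] .nt) :
    I .nat (.cons t .nil) ↔ ∃ n, t.Conv (num n) := by
  rw [← hI]
  refine ⟨?_, fun ⟨n, hn⟩ => .inl ⟨n, .atom _ (.cons hn .nil)⟩⟩
  rintro (⟨n, hn⟩ | ⟨hp, -⟩)
  · cases hn.args with | cons h _ => exact ⟨n, h⟩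
  · exact absurd rfl hp

theorem defined_iff (hI : IsModel D I) {p : Pred S} (hp : p ≠ .nat) (us : Tms S ℕ [] p.arity) :
    I p us ↔ ∃ c ∈ D, ∃ η : Assign S ℕ c.ctx [],
      (Form.atom p us : MForm S ℕ []).Conv (Clause.formInst c.head η) ∧
        c.body.Holds I .empty η := by
  rw [← hI]
  exact (or_iff_right fun ⟨_, hn⟩ => hp hn.pred_eq).trans (by rw [hI]; exact and_iff_right hp)

end IsModel

/-- The sequent `Γ ⟶ B` is valid in `I`: every substitution that makes all formulas of `Γ` true
makes `B` true. -/
def Valid (I : Interp S (Pred.arity (S := S))) (Γ : Multiset (MForm S ℕ [])) (B : MForm S ℕ []) :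
    Prop :=
  ∀ θ : NameSubst S ℕ ℕ [], (∀ F ∈ Γ, F.Holds I θ Assign.none) → B.Holds I θ Assign.none

namespace Valid
variable {Γ Δ : Multiset (MForm S ℕ [])} {B C : MForm S ℕ []} {τ : Ty S.Ground}

theorem cons_iff : Valid I (B ::ₘ Γ) C ↔ ∀ θ : NameSubst S ℕ ℕ [], B.Holds I θ Assign.none →
    (∀ F ∈ Γ, F.Holds I θ Assign.none) → C.Holds I θ Assign.none := by
  simp only [Valid, Multiset.forall_mem_cons, and_imp]

theorem conv (hI : ConvInvariant I) {Γ' : Multiset (MForm S ℕ [])}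
    (hΓ : Multiset.Rel Form.Conv Γ Γ') (hB : B.Conv C) (h : Valid I Γ B) : Valid I Γ' C := by
  refine fun θ hθ => (hB.forces_iff fun _ => hI).1 (h θ fun F hF => ?_)
  obtain ⟨F', hF', hFF'⟩ := Multiset.exists_mem_of_rel_of_mem hΓ hF
  exact (hFF'.forces_iff fun _ => hI).2 (hθ F' hF')

theorem cut (hB : Valid I Δ B) (hC : Valid I (B ::ₘ Γ) C) : Valid I (Δ + Γ) C :=
  fun θ hθ => cons_iff.1 hC θ (hB θ fun F hF => hθ F (Multiset.mem_add.2 (.inl hF)))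
    fun F hF => hθ F (Multiset.mem_add.2 (.inr hF))

theorem allR {B : MForm S ℕ [τ]} {y : ℕ} (hΓ : ∀ F ∈ Γ, ¬ F.Occurs τ y) (hB : ¬ B.Occurs τ y)
    (h : Valid I Γ (B.inst (.free τ y))) : Valid I Γ (.all τ B) :=
  fun θ hθ t => (Form.forces_inst_update hB θ t).1
    (h _ fun F hF => (Form.forces_update (hΓ F hF) θ t).2 (hθ F hF))

theorem exL {B : MForm S ℕ [τ]} {y : ℕ} (hΓ : ∀ F ∈ Γ, ¬ F.Occurs τ y) (hB : ¬ B.Occurs τ y)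
    (hC : ¬ C.Occurs τ y) (h : Valid I (B.inst (.free τ y) ::ₘ Γ) C) :
    Valid I (.ex τ B ::ₘ Γ) C :=
  cons_iff.2 fun θ ⟨t, ht⟩ hθ => (Form.forces_update hC θ t).1 <|
    cons_iff.1 h _ ((Form.forces_inst_update hB θ t).2 ht)
      fun F hF => (Form.forces_update (hΓ F hF) θ t).2 (hθ F hF)

theorem holds_num {B : MForm S ℕ [.nt]} {j : ℕ} (hj : ¬ B.Occurs .nt j)
    (hzero : Valid I 0 (B.inst zeroT))
    (hsuc : Valid I {B.inst (.free .nt j)} (B.inst (sucT (.free .nt j)))) (θ : NameSubst S ℕ ℕ [])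
    (n : ℕ) : B.Holds I θ (Assign.cons (num n) Assign.none) := by
  induction n with
  | zero =>
    exact (Form.forces_inst _ _ θ _ _).1 (hzero θ fun F hF => absurd hF (Multiset.notMem_zero F))
  | succ n ih =>
    have holds_suc : (B.inst (sucT (.free .nt j))).Holds I (θ.update .nt j (num n)) Assign.none :=
      hsuc _ fun F hF => Multiset.mem_singleton.1 hF ▸ (Form.forces_inst_update hj θ _).2 ih
    rw [Form.Holds, Form.forces_inst, Form.forces_update hj] at holds_suc
    simpa only [Tm.bind, num, sucT, NameSubst.update_same] using holds_suc

theorem natL (hI : IsModel D I) {t : Tm S ℕ [] .nt} {B : MForm S ℕ [.nt]} {j : ℕ}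
    (hj : ¬ B.Occurs .nt j) (hzero : Valid I 0 (B.inst zeroT))
    (hsuc : Valid I {B.inst (.free .nt j)} (B.inst (sucT (.free .nt j))))
    (h : Valid I (B.inst t ::ₘ Γ) C) : Valid I (natF t ::ₘ Γ) C := by
  refine cons_iff.2 fun θ ht => cons_iff.1 h θ ((Form.forces_inst _ _ θ _ _).2 ?_)
  obtain ⟨n, hn⟩ := (hI.nat_iff _).1 ht
  exact (B.forces_conv_assign (fun _ => hI.convInvariant) (fun _ _ => .refl _)
    (Assign.cons_conv hn.symm fun _ _ => .refl _)).1 (holds_num hj hzero hsuc θ n)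

theorem defR (hI : IsModel D I) {p : Pred S} {us : Tms S ℕ [] p.arity} {c : Clause S}
    {η : Assign S ℕ c.ctx []} (hp : p ≠ .nat) (hc : c ∈ D)
    (hη : (Form.atom p us : MForm S ℕ []).Conv (Clause.formInst c.head η))
    (h : Valid I Γ (Clause.formInst c.body η)) : Valid I Γ (.atom p us) := by
  refine fun θ hθ => (hI.defined_iff hp _).2
    ⟨c, hc, _, ?_, (Clause.holds_formInst _ _ _).1 (h θ hθ)⟩
  rw [← Clause.formInst_bind]
  exact hη.bind θ Assign.none

theorem defL (hI : IsModel D I) {p : Pred S} {us : Tms S ℕ [] p.arity}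
    {U : (c : Clause S) → Set (ClauseSubst c)} (hp : p ≠ .nat)
    (hU : ∀ c ∈ D, IsCSU (.atom p us) c (U c))
    (h : ∀ c ∈ D, ∀ π ∈ U c,
      Valid I (Clause.formInst c.body π.vars ::ₘ Γ.map (MForm.subst π.names)) (C.subst π.names)) :
    Valid I (.atom p us ::ₘ Γ) C := by
  refine cons_iff.2 fun θ hatom hθ => ?_
  obtain ⟨c, hc, η, hη, hbody⟩ := (hI.defined_iff hp _).1 hatom
  obtain ⟨π, hπ, σ, hnames, hvars⟩ := (hU c hc).2 ⟨θ, η⟩ hη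
  have holds_subst (F : MForm S ℕ []) :
      (F.subst π.names).Holds I σ Assign.none ↔ F.Holds I θ Assign.none := by
    rw [Form.Holds, MForm.subst, Form.forces_bind]
    exact F.forces_conv_assign (fun _ => hI.convInvariant) (fun τ n => (hnames τ n).symm)
      fun τ x => nomatch x
  refine (holds_subst C).1 (cons_iff.1 (h c hc π hπ) σ ?_ fun F hF => ?_)
  · exact (Clause.holds_formInst _ _ _).2 ((c.body.forces_conv_assign
      (fun _ => hI.convInvariant) (fun _ _ => .refl _) hvars).1 hbody)
  · obtain ⟨G, hG, rfl⟩ := Multiset.mem_map.1 hF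
    exact (holds_subst G).2 (hθ G hG)

end Valid

theorem Derivable.valid (hI : IsModel D I) {Γ : Multiset (MForm S ℕ [])} {B : MForm S ℕ []}
    (h : Derivable D Γ B) : Valid I Γ B := by
  induction h with
  | conv hΓ hB _ ih => exact ih.conv hI.convInvariant hΓ hB
  | botL => exact Valid.cons_iff.2 fun _ h => h.elim
  | topR => exact fun _ _ => trivial
  | andL₁ _ ih => exact Valid.cons_iff.2 fun θ h => Valid.cons_iff.1 ih θ h.1
  | andL₂ _ ih => exact Valid.cons_iff.2 fun θ h => Valid.cons_iff.1 ih θ h.2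
  | andR _ _ ih ih' => exact fun θ h => ⟨ih θ h, ih' θ h⟩
  | orL _ _ ih ih' =>
    exact Valid.cons_iff.2 fun θ h => h.elim (Valid.cons_iff.1 ih θ) (Valid.cons_iff.1 ih' θ)
  | orR₁ _ ih => exact fun θ h => .inl (ih θ h)
  | orR₂ _ ih => exact fun θ h => .inr (ih θ h)
  | impL _ _ ih ih' =>
    exact Valid.cons_iff.2 fun θ h hΓ => Valid.cons_iff.1 ih' θ (h _ le_rfl (ih θ hΓ)) hΓ
  | impR _ ih => exact fun θ h _ _ hB => Valid.cons_iff.1 ih θ hB h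
  | allL t _ ih =>
    exact Valid.cons_iff.2 fun θ h =>
      Valid.cons_iff.1 ih θ ((Form.forces_inst _ t θ _ _).2 (h _))
  | allR y hΓ hB _ ih => exact ih.allR hΓ hB
  | exL y hΓ hB hC _ ih => exact ih.exL hΓ hB hC
  | exR t _ ih => exact fun θ h => ⟨_, (Form.forces_inst _ t θ _ _).1 (ih θ h)⟩
  | init p ts => exact Valid.cons_iff.2 fun _ h _ => h
  | contrL _ ih =>
    exact Valid.cons_iff.2 fun θ h hΓ =>
      Valid.cons_iff.1 ih θ h (Multiset.forall_mem_cons.2 ⟨h, hΓ⟩)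
  | cut _ _ ih ih' => exact ih.cut ih'
  | natR_zero => exact fun _ _ => (hI.nat_iff _).2 ⟨0, .refl _⟩
  | natR_suc _ ih =>
    exact fun θ h => (hI.nat_iff _).2 <|
      ((hI.nat_iff _).1 (ih θ h)).elim fun n hn => ⟨n + 1, .app (.refl _) hn⟩
  | natL B j hj _ _ _ hzero hsuc ih => exact .natL hI hj hzero hsuc ih
  | defR p us c η hp hc hη _ ih => exact ih.defR hI hp hc hη
  | defL p us U hp hU _ ih => exact .defL hI hp hU ih

end Soundness

/-! ## Translations and closed formulas -/

section Translations
variable {S : Signature.{u}} {N N' : Type} {Γ Δ : List (Ty S.Ground)}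

theorem Translates.bind {B : Tm S N Γ .prp} {φ : OForm S N Γ} (h : Translates B φ)
    (θ : NameSubst S N N' Δ) (η : Assign S N' Γ Δ) : Translates (B.bind θ η) (φ.bind θ η) := by
  induction h generalizing Δ with
  | atom a => exact .atom _
  | tt => exact .tt
  | and _ _ ih ih' => exact .and (ih θ η) (ih' θ η)
  | imp a _ ih => exact .imp _ (ih θ η)
  | all _ ih => exact .all (ih _ _)
  | conv h _ ih => exact .conv (h.bind θ η) (ih θ η)

/-- `Translates` without conversion at the root: the outermost constructor of the term is
explicit. -/
inductive TranslatesHead : Tm S N Γ .prp → OForm S N Γ → Prop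
  | atom (a : Tm S N Γ .atm) : TranslatesHead (atomT a) (OForm.atm a)
  | tt : TranslatesHead ttT .top
  | and {b c : Tm S N Γ .prp} {φ ψ : OForm S N Γ} :
      Translates b φ → Translates c ψ → TranslatesHead (andT b c) (.and φ ψ)
  | imp (a : Tm S N Γ .atm) {b : Tm S N Γ .prp} {φ : OForm S N Γ} :
      Translates b φ → TranslatesHead (impT a b) (.imp (OForm.atm a) φ)
  | all {b : Tm S N (.i :: Γ) .prp} {φ : OForm S N (.i :: Γ)} :
      Translates b φ → TranslatesHead (allT (.lam b)) (.all .i φ)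

theorem Translates.exists_head {B : Tm S N Γ .prp} {φ : OForm S N Γ} (h : Translates B φ) :
    ∃ B', B'.Conv B ∧ TranslatesHead B' φ := by
  induction h with
  | atom a => exact ⟨_, .refl _, .atom a⟩
  | tt => exact ⟨_, .refl _, .tt⟩
  | and h h' => exact ⟨_, .refl _, .and h h'⟩
  | imp a h => exact ⟨_, .refl _, .imp a h⟩
  | all h => exact ⟨_, .refl _, .all h⟩
  | conv h _ ih => exact ih.imp fun _ hB => ⟨hB.1.trans h, hB.2⟩

namespace Translates
variable {φ : OForm S ℕ []}

theorem inv_atomT {a : Tm S ℕ [] .atm} (h : Translates (atomT a) φ) :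
    ∃ a', a'.Conv a ∧ φ = OForm.atm a' := by
  obtain ⟨B', hB', h⟩ := h.exists_head
  cases h with
  | atom a' => exact ⟨a', atomT_conv_inj hB', rfl⟩
  | _ => cases hB'.shape_eq

theorem inv_ttT (h : Translates ttT φ) : φ = .top := by
  obtain ⟨B', hB', h⟩ := h.exists_head
  cases h with
  | tt => rfl
  | _ => cases hB'.shape_eq

theorem inv_andT {b c : Tm S ℕ [] .prp} (h : Translates (andT b c) φ) :
    ∃ φ₁ φ₂, φ = .and φ₁ φ₂ ∧ Translates b φ₁ ∧ Translates c φ₂ := by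
  obtain ⟨B', hB', h⟩ := h.exists_head
  cases h with
  | and hb hc =>
    exact ⟨_, _, rfl, hb.conv (andT_conv_inj hB').1, hc.conv (andT_conv_inj hB').2⟩
  | _ => cases hB'.shape_eq

theorem inv_impT {a : Tm S ℕ [] .atm} {b : Tm S ℕ [] .prp} (h : Translates (impT a b) φ) :
    ∃ a' ψ, a'.Conv a ∧ φ = .imp (OForm.atm a') ψ ∧ Translates b ψ := by
  obtain ⟨B', hB', h⟩ := h.exists_head
  cases h with
  | imp a' hb => exact ⟨a', _, (impT_conv_inj hB').1, rfl, hb.conv (impT_conv_inj hB').2⟩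
  | _ => cases hB'.shape_eq

theorem inv_allT {b : Tm S ℕ [] (.arr .i .prp)} (h : Translates (allT b) φ) :
    ∃ b' ψ, (Tm.lam b').Conv b ∧ φ = .all .i ψ ∧ Translates b' ψ := by
  obtain ⟨B', hB', h⟩ := h.exists_head
  cases h with
  | all hb => exact ⟨_, _, allT_conv_inj hB', rfl, hb⟩
  | _ => cases hB'.shape_eq

end Translates

/-- The term of type `atmlst` with the given elements. -/
def listT : List (Tm S N Γ .atm) → Tm S N Γ .atmlst
  | [] => nilT
  | a :: l => consT a (listT l)

theorem TranslatesList.exists_list {L : Tm S N [] .atmlst} {M : Multiset (OForm S N [])}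
    (h : TranslatesList L M) :
    ∃ l : List (Tm S N [] .atm), (listT l).Conv L ∧ M = l.map OForm.atm := by
  induction h with
  | nil => exact ⟨[], .refl _, rfl⟩
  | cons a _ ih =>
    obtain ⟨l, hl, rfl⟩ := ih
    exact ⟨a :: l, .app (.refl _) hl, rfl⟩
  | conv h _ ih => exact ih.imp fun _ hl => ⟨hl.1.trans h, hl.2⟩

end Translations

section Closed
variable {S : Signature.{u}} {P : Type u} {ar : P → List (Ty S.Ground)} {N : Type}
  {Γ Δ τs : List (Ty S.Ground)} {σ τ : Ty S.Ground} {n : N}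

theorem Tm.occurs_rename (t : Tm S N Γ τ) (ρ : ∀ τ : Ty S.Ground, Var Γ τ → Var Δ τ) :
    (t.rename ρ).Occurs σ n ↔ t.Occurs σ n := by
  induction t generalizing Δ with
  | bvar | free | const => rfl
  | app t t' ih ih' => exact or_congr (ih ρ) (ih' ρ)
  | lam _ ih => exact ih _

theorem Assign.not_occurs_lift {σ' : Ty S.Ground} {η : Assign S N Γ Δ}
    (h : ∀ τ x, ¬ (η τ x).Occurs σ n) (τ : Ty S.Ground) (x : Var (σ' :: Γ) τ) :
    ¬ (η.lift σ' τ x).Occurs σ n := by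
  cases x with
  | zero => exact id
  | succ x => exact fun ho => h _ x ((Tm.occurs_rename _ _).1 ho)

theorem Tm.not_occurs_bind (t : Tm S Empty Γ τ) (θ : NameSubst S Empty N Δ) {η : Assign S N Γ Δ}
    (h : ∀ τ x, ¬ (η τ x).Occurs σ n) : ¬ (t.bind θ η).Occurs σ n := by
  induction t generalizing Δ with
  | bvar x => exact h _ x
  | free _ m => exact m.elim
  | const => exact id
  | app t t' ih ih' => exact not_or.2 ⟨ih θ h, ih' θ h⟩
  | lam _ ih => exact ih _ (Assign.not_occurs_lift h)

theorem Tms.not_occurs_bind (ts : Tms S Empty Γ τs) (θ : NameSubst S Empty N Δ)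
    {η : Assign S N Γ Δ} (h : ∀ τ x, ¬ (η τ x).Occurs σ n) : ¬ (ts.bind θ η).Occurs σ n := by
  induction ts with
  | nil => exact id
  | cons t ts ih => exact not_or.2 ⟨t.not_occurs_bind θ h, ih⟩

namespace Form

theorem not_occurs_bind (B : Form S ar Empty Γ) (θ : NameSubst S Empty N Δ) {η : Assign S N Γ Δ}
    (h : ∀ τ x, ¬ (η τ x).Occurs σ n) : ¬ (B.bind θ η).Occurs σ n := by
  induction B generalizing Δ with
  | atom p ts => exact ts.not_occurs_bind θ h
  | top | bot => exact id
  | and _ _ ih ih' | or _ _ ih ih' | imp _ _ ih ih' => exact not_or.2 ⟨ih θ h, ih' θ h⟩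
  | all _ _ ih | ex _ _ ih => exact ih _ (Assign.not_occurs_lift h)

theorem not_occurs_ofClosed (B : Form S ar Empty Γ) : ¬ (B.ofClosed : Form S ar N Γ).Occurs σ n :=
  B.not_occurs_bind _ fun _ _ => id

theorem ofClosed_eq_bind (B : Form S ar Empty []) :
    (B.ofClosed : Form S ar N []) = B.bind .empty Assign.none := by
  rw [ofClosed, NameSubst.eq_empty fun _ n => n.elim, Assign.eq_none fun _ x => .bvar x]

end Form

end Closed

section Hypotheses
variable {S : Signature.{u}} {Γ : List (Ty S.Ground)} {T : Set (ProgClause S)}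
  {l : List (Tm S ℕ [] .atm)}

theorem Entails.bind_of_close {H : Set (OForm S ℕ [])} :
    {Γ : List (Ty S.Ground)} → {B : OForm S Empty Γ} →
    Entails H ((Form.close Γ B).bind .empty Assign.none) →
    ∀ η : Assign S ℕ Γ [], Entails H (B.bind .empty η)
  | [], _, h, η => η.eq_none ▸ h
  | σ :: Γ, B, h, η => by
    have h' := (Entails.bind_of_close (Γ := Γ) (B := .all σ B) h fun τ x => η τ (.succ x)).allE
      (η σ .zero)
    rwa [Form.bind_lift_inst, Assign.cons_head_tail] at h'

/-- The hypotheses of the object-level sequents: the atoms of the list `l` and the formulas of the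
theory `T`. -/
def hypotheses (T : Set (ProgClause S)) (l : List (Tm S ℕ [] .atm)) : Set (OForm S ℕ []) :=
  {F | F ∈ l.map OForm.atm} ∪ ProgClause.toForm '' T

theorem hypotheses_cons (a : Tm S ℕ [] .atm) :
    hypotheses T (a :: l) = insert (OForm.atm a) (hypotheses T l) := by
  ext F
  simp only [hypotheses, List.map_cons, List.mem_cons, Set.mem_union, Set.mem_ofPred_eq,
    Set.mem_insert_iff, or_assoc]

theorem entails_atm_of_mem {a : Tm S ℕ [] .atm} (ha : a ∈ l) :
    Entails (hypotheses T l) (OForm.atm a) :=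
  .hyp (.inl (List.mem_map_of_mem ha))

theorem entails_progClause {c : ProgClause S} (hc : c ∈ T) (η : Assign S ℕ c.ctx [])
    (h : Entails (hypotheses T l) (c.transG.bind .empty η)) :
    Entails (hypotheses T l) (OForm.atm (c.A.bind .empty η)) := by
  have hT : Entails (hypotheses T l) c.toForm := .hyp (.inr ⟨c, hc, rfl⟩)
  rw [ProgClause.toForm, Form.ofClosed_eq_bind] at hT
  exact (hT.bind_of_close η).impE h

theorem eventually_forall_mem_not_occurs {τ : Ty S.Ground} (l : List (Tm S ℕ Γ τ))
    (σ : Ty S.Ground) : ∀ᶠ n in Filter.cofinite, ∀ a ∈ l, ¬ a.Occurs σ n :=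
  (Filter.eventually_all_finite l.finite_toSet).2 fun a _ => a.eventually_not_occurs σ

theorem not_occurs_of_mem_hypotheses {σ : Ty S.Ground} {n : ℕ} (h : ∀ a ∈ l, ¬ a.Occurs σ n)
    {F : OForm S ℕ []} (hF : F ∈ hypotheses T l) : ¬ F.Occurs σ n := by
  obtain hF | ⟨c, -, rfl⟩ := hF
  · obtain ⟨a, ha, rfl⟩ := List.mem_map.1 hF
    exact not_or.2 ⟨h a ha, id⟩
  · exact Form.not_occurs_ofClosed _

end Hypotheses

/-! ## True encoded sequents hold in the object logic -/

/-- The clauses of `D` for `element`, `seq` and `prog` are those of the encoding of the theory `T`;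
the clauses for the other predicates are arbitrary. -/
structure Encodes {S : Signature.{u}} (D : Set (Clause S)) (T : Set (ProgClause S)) : Prop where
  mem_iff_of_element : ∀ c : Clause S, c.pred = .element → (c ∈ D ↔ c ∈ defList S)
  mem_iff_of_seq : ∀ c : Clause S, c.pred = .seq → (c ∈ D ↔ c ∈ defIntuit S)
  mem_iff_of_prog : ∀ c : Clause S, c.pred = .prog → (c ∈ D ↔ c ∈ ProgClause.toClause '' T)

section Predicates
variable {S : Signature.{u}} {c : Clause S}

theorem pred_ne_of_mem_defNat (hc : c ∈ defNat S) :
    c.pred ≠ .seq ∧ c.pred ≠ .element ∧ c.pred ≠ .prog := by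
  rcases hc with rfl | rfl | rfl | rfl | rfl | rfl | rfl <;> exact ⟨nofun, nofun, nofun⟩

theorem pred_ne_of_mem_defList (hc : c ∈ defList S) : c.pred ≠ .seq ∧ c.pred ≠ .prog := by
  rcases hc with rfl | rfl | rfl | rfl | rfl | rfl | rfl | rfl | rfl | rfl <;>
    exact ⟨nofun, nofun⟩

theorem pred_eq_seq_of_mem_defIntuit (hc : c ∈ defIntuit S) : c.pred = .seq := by
  rcases hc with rfl | rfl | rfl | rfl | rfl | rfl <;> rfl

variable {D E : Set (Clause S)} {T : Set (ProgClause S)}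

theorem Encodes.of_union
    (hE : ∀ c ∈ E, c.pred ≠ .seq ∧ c.pred ≠ .element ∧ c.pred ≠ .prog) :
    Encodes (defNat S ∪ defList S ∪ defIntuit S ∪ ProgClause.toClause '' T ∪ E) T where
  mem_iff_of_element c hp := by
    refine ⟨?_, fun h => .inl (.inl (.inl (.inr h)))⟩
    rintro ((((h | h) | h) | ⟨d, -, rfl⟩) | h)
    · exact absurd hp (pred_ne_of_mem_defNat h).2.1
    · exact h
    · cases hp.symm.trans (pred_eq_seq_of_mem_defIntuit h)
    · cases hp
    · exact absurd hp (hE c h).2.1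
  mem_iff_of_seq c hp := by
    refine ⟨?_, fun h => .inl (.inl (.inr h))⟩
    rintro ((((h | h) | h) | ⟨d, -, rfl⟩) | h)
    · exact absurd hp (pred_ne_of_mem_defNat h).1
    · exact absurd hp (pred_ne_of_mem_defList h).1
    · exact h
    · cases hp
    · exact absurd hp (hE c h).1
  mem_iff_of_prog c hp := by
    refine ⟨?_, fun h => .inl (.inr h)⟩
    rintro ((((h | h) | h) | h) | h)
    · exact absurd hp (pred_ne_of_mem_defNat h).2.2
    · exact absurd hp (pred_ne_of_mem_defList h).2
    · cases hp.symm.trans (pred_eq_seq_of_mem_defIntuit h)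
    · exact h
    · exact absurd hp (hE c h).2.2

theorem Encodes.defIntuit_subset (hD : Encodes D T) : defIntuit S ⊆ D := fun c hc =>
  (hD.mem_iff_of_seq c (pred_eq_seq_of_mem_defIntuit hc)).2 hc

end Predicates

section Extraction
variable {S : Signature.{u}} {T : Set (ProgClause S)} {D : Set (Clause S)}
  {I : Interp S (Pred.arity (S := S))}

theorem Tms.Conv.inv_cons {N : Type} {Γ τs : List (Ty S.Ground)} {τ : Ty S.Ground}
    {t t' : Tm S N Γ τ} {ts ts' : Tms S N Γ τs} (h : (Tms.cons t ts).Conv (.cons t' ts')) :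
    t.Conv t' ∧ ts.Conv ts' := by
  cases h with | cons h h' => exact ⟨h, h'⟩

theorem seqF_conv_inj {n n' : Tm S ℕ [] .nt} {l l' : Tm S ℕ [] .atmlst} {b b' : Tm S ℕ [] .prp}
    (h : (seqF n l b).Conv (seqF n' l' b')) : n.Conv n' ∧ l.Conv l' ∧ b.Conv b' :=
  ⟨h.args.inv_cons.1, h.args.inv_cons.2.inv_cons.1, h.args.inv_cons.2.inv_cons.2.inv_cons.1⟩

theorem elementF_conv_inj {a a' : Tm S ℕ [] .atm} {l l' : Tm S ℕ [] .atmlst}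
    (h : (elementF a l).Conv (elementF a' l')) : a.Conv a' ∧ l.Conv l' :=
  ⟨h.args.inv_cons.1, h.args.inv_cons.2.inv_cons.1⟩

theorem progF_conv_inj {a a' : Tm S ℕ [] .atm} {b b' : Tm S ℕ [] .prp}
    (h : (progF a b).Conv (progF a' b')) : a.Conv a' ∧ b.Conv b' :=
  ⟨h.args.inv_cons.1, h.args.inv_cons.2.inv_cons.1⟩

theorem exists_num_of_conv_sucT {n : ℕ} {t : Tm S ℕ [] .nt} (h : (num n).Conv (sucT t)) :
    ∃ m, n = m + 1 ∧ (num m).Conv t := by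
  cases n with
  | zero => cases h.shape_eq
  | succ m => exact ⟨m, rfl, sucT_conv_inj h⟩

namespace Encodes

theorem element_cases (hD : Encodes D T) (hI : IsModel D I) {a : Tm S ℕ [] .atm}
    {L : Tm S ℕ [] .atmlst} (h : I .element (.cons a (.cons L .nil))) :
    ∃ a' L', L.Conv (consT a' L') ∧ (a.Conv a' ∨ I .element (.cons a (.cons L' .nil))) := by
  obtain ⟨c, hc, η, hη, hbody⟩ := (hI.defined_iff (p := .element) nofun _).1 h
  have hc := (hD.mem_iff_of_element c hη.pred_eq.symm).1 hc
  rcases hc with rfl | rfl | rfl | rfl | rfl | rfl | rfl | rfl | rfl | rfl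
  case inr.inr.inr.inl =>
    obtain ⟨ha, hL⟩ := elementF_conv_inj (a' := η _ .zero)
      (l' := consT (η _ .zero) (η _ (.succ .zero))) hη
    exact ⟨_, _, hL, .inl ha⟩
  case inr.inr.inr.inr.inl =>
    obtain ⟨ha, hL⟩ := elementF_conv_inj (a' := η _ .zero)
      (l' := consT (η _ (.succ .zero)) (η _ (.succ (.succ .zero)))) hη
    exact ⟨_, _, hL, .inr (hI.convInvariant _ _ _ (.cons ha.symm (.refl _)) hbody)⟩
  all_goals cases hη.pred_eq

theorem exists_mem_of_element (hD : Encodes D T) (hI : IsModel D I) {l : List (Tm S ℕ [] .atm)}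
    {L : Tm S ℕ [] .atmlst} (hL : (listT l).Conv L) {a : Tm S ℕ [] .atm}
    (h : I .element (.cons a (.cons L .nil))) : ∃ a' ∈ l, a'.Conv a := by
  induction l generalizing L with
  | nil =>
    obtain ⟨_, _, hL', -⟩ := hD.element_cases hI h
    cases (hL.trans hL').shape_eq
  | cons a₀ l ih =>
    obtain ⟨a', L', hL', h⟩ := hD.element_cases hI h
    obtain ⟨ha, hl⟩ := consT_conv_inj (hL.trans hL')
    rcases h with h | h
    · exact ⟨a₀, List.mem_cons_self, ha.trans h.symm⟩
    · exact (ih hl h).imp fun _ => .imp_left (List.mem_cons_of_mem _)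

theorem exists_progClause_of_prog (hD : Encodes D T) (hI : IsModel D I) {a : Tm S ℕ [] .atm}
    {b : Tm S ℕ [] .prp} (h : I .prog (.cons a (.cons b .nil))) :
    ∃ c ∈ T, ∃ η : Assign S ℕ c.ctx [],
      a.Conv (c.A.bind .empty η) ∧ b.Conv (c.G.bind .empty η) := by
  obtain ⟨c, hc, η, hη, -⟩ := (hI.defined_iff (p := .prog) nofun _).1 h
  obtain ⟨d, hd, rfl⟩ := (hD.mem_iff_of_prog c hη.pred_eq.symm).1 hc
  exact ⟨d, hd, η, progF_conv_inj hη⟩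

theorem seq_cases (hD : Encodes D T) (hI : IsModel D I) {n : Tm S ℕ [] .nt} {L : Tm S ℕ [] .atmlst}
    {B : Tm S ℕ [] .prp} (h : I .seq (.cons n (.cons L (.cons B .nil)))) :
    (∃ a, B.Conv (atomT a) ∧ I .element (.cons a (.cons L .nil))) ∨ B.Conv ttT ∨
    ∃ m, n.Conv (sucT m) ∧
      ((∃ b c, B.Conv (andT b c) ∧ I .seq (.cons m (.cons L (.cons b .nil))) ∧
          I .seq (.cons m (.cons L (.cons c .nil)))) ∨
        (∃ a b, B.Conv (impT a b) ∧ I .seq (.cons m (.cons (consT a L) (.cons b .nil)))) ∨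
        (∃ b, B.Conv (allT b) ∧ ∀ t, I .seq (.cons m (.cons L (.cons (.app b t) .nil)))) ∨
        ∃ a b, B.Conv (atomT a) ∧ I .prog (.cons a (.cons b .nil)) ∧
          I .seq (.cons m (.cons L (.cons b .nil)))) := by
  obtain ⟨c, hc, η, hη, hbody⟩ := (hI.defined_iff (p := .seq) nofun _).1 h
  have hc := (hD.mem_iff_of_seq c hη.pred_eq.symm).1 hc
  have hseq {m l l' b} (hl : l.Conv l') (h : I .seq (.cons m (.cons l' (.cons b .nil)))) :
      I .seq (.cons m (.cons l (.cons b .nil))) :=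
    hI.convInvariant _ _ _ (.cons (.refl _) (.cons hl.symm (.refl _))) h
  rcases hc with rfl | rfl | rfl | rfl | rfl | rfl
  · obtain ⟨-, hL, hB⟩ := seqF_conv_inj (b' := atomT (η _ (.succ (.succ (.succ .zero))))) hη
    exact .inl ⟨_, hB, hI.convInvariant _ _ _ (.cons (.refl _) (.cons hL.symm .nil)) hbody⟩
  · exact .inr (.inl (seqF_conv_inj (b' := ttT) hη).2.2)
  all_goals refine .inr (.inr ⟨η _ .zero, (seqF_conv_inj (n' := sucT (η _ .zero)) hη).1, ?_⟩)
  · obtain ⟨-, hL, hB⟩ := seqF_conv_inj (l' := η _ (.succ .zero))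
      (b' := andT (η _ (.succ (.succ .zero))) (η _ (.succ (.succ (.succ .zero))))) hη
    exact .inl ⟨_, _, hB, hseq hL hbody.1, hseq hL hbody.2⟩
  · obtain ⟨-, hL, hB⟩ := seqF_conv_inj (l' := η _ (.succ .zero))
      (b' := impT (η _ (.succ (.succ .zero))) (η _ (.succ (.succ (.succ .zero))))) hη
    exact .inr (.inl ⟨_, _, hB, hseq (.app (.refl _) hL) hbody⟩)
  · obtain ⟨-, hL, hB⟩ := seqF_conv_inj (l' := η _ (.succ .zero))
      (b' := allT (η _ (.succ (.succ .zero)))) hη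
    exact .inr (.inr (.inl ⟨_, hB, fun t => hseq hL (hbody t)⟩))
  · obtain ⟨-, hL, hB⟩ := seqF_conv_inj (l' := η _ (.succ .zero))
      (b' := atomT (η _ (.succ (.succ .zero)))) hη
    obtain ⟨b, hprog, hbody⟩ := hbody
    exact .inr (.inr (.inr ⟨_, b, hB, hprog, hseq hL hbody⟩))

theorem entails_of_seq (hD : Encodes D T) (hI : IsModel D I) {n : ℕ} {t : Tm S ℕ [] .nt}
    (ht : (num n).Conv t) {l : List (Tm S ℕ [] .atm)} {L : Tm S ℕ [] .atmlst}
    (hL : (listT l).Conv L) {B : Tm S ℕ [] .prp} {φ : OForm S ℕ []} (hB : Translates B φ)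
    (h : I .seq (.cons t (.cons L (.cons B .nil)))) : Entails (hypotheses T l) φ := by
  induction n using Nat.strong_induction_on generalizing t l L B φ with | _ n ih
  rcases hD.seq_cases hI h with ⟨a, hB', ha⟩ | hB' | ⟨t', ht', hstep⟩
  · obtain ⟨a', ha', rfl⟩ := (hB.conv hB').inv_atomT
    obtain ⟨a'', hmem, haa⟩ := hD.exists_mem_of_element hI hL ha
    exact (entails_atm_of_mem hmem).conv (.atom _ (.cons (haa.trans ha'.symm) .nil))
  · rw [(hB.conv hB').inv_ttT]
    exact .topI
  obtain ⟨m, rfl, hm⟩ := exists_num_of_conv_sucT (ht.trans ht')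
  replace ih := @ih m m.lt_succ_self t' hm
  rcases hstep with ⟨b, c, hB', hb, hc⟩ | ⟨a, b, hB', hb⟩ | ⟨b, hB', hb⟩ | ⟨a, b, hB', hprog, hb⟩
  · obtain ⟨φ₁, φ₂, rfl, h₁, h₂⟩ := (hB.conv hB').inv_andT
    exact .andI (ih hL h₁ hb) (ih hL h₂ hc)
  · obtain ⟨a', φ₁, ha, rfl, h₁⟩ := (hB.conv hB').inv_impT
    refine .impI ?_
    rw [← hypotheses_cons]
    exact ih (l := a' :: l) (.app (.app (.refl _) ha) hL) h₁ hb
  · obtain ⟨b', φ₁, hb', rfl, h₁⟩ := (hB.conv hB').inv_allT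
    obtain ⟨y, hl, hφ⟩ := ((eventually_forall_mem_not_occurs l .i).and
      (φ₁.eventually_not_occurs .i)).exists
    have happ : Tm.Conv (b'.inst (.free .i y)) (.app b (.free .i y)) :=
      (Tm.Conv.beta b' (.free .i y)).symm.trans (hb'.app (.refl _))
    exact .allI y (fun _ => not_occurs_of_mem_hypotheses hl) hφ
      (ih hL ((h₁.bind _ _).conv happ) (hb _))
  · obtain ⟨a', ha, rfl⟩ := (hB.conv hB').inv_atomT
    obtain ⟨c, hc, η, hA, hG⟩ := hD.exists_progClause_of_prog hI hprog
    have hbody := ih hL ((c.translates.bind .empty η).conv hG.symm) hb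
    exact (entails_progClause hc η hbody).conv (.atom _ (.cons (hA.symm.trans ha.symm) .nil))

theorem entails_of_derivable_prv (hD : Encodes D T) {lvl : Pred S → ℕ}
    (hlvl : ∀ c ∈ D, c.body.level lvl ≤ lvl c.pred) {l : List (Tm S ℕ [] .atm)}
    {L : Tm S ℕ [] .atmlst} {B : Tm S ℕ [] .prp} {φ : OForm S ℕ []} (hL : (listT l).Conv L)
    (hB : Translates B φ) (h : Derivable D 0 (prv L B)) : Entails (hypotheses T l) φ := by
  obtain ⟨I, hI⟩ := exists_isModel hlvl
  obtain ⟨t, hnat, hseq⟩ := h.valid hI .free fun F hF => nomatch hF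
  obtain ⟨n, hn⟩ := (hI.nat_iff _).1 hnat
  have bind_wk {τ : Ty S.Ground} (r : Tm S ℕ [] τ) :
      r.wk.bind .free (Assign.none.cons t) = r :=
    (Tm.wk_bind_cons _ _ _ _).trans r.bind_id_none
  refine hD.entails_of_seq hI hn.symm hL hB ?_
  rw [← bind_wk L, ← bind_wk B]
  exact hseq

end Encodes
end Extraction

/-! ## Completeness of goal-directed proofs -/

theorem Entails.forces {S : Signature.{u}} {W : Type*} [Preorder W] {I : W → Interp S (objArity S)}
    (hmono : Monotone I) (hconv : ∀ w, ConvInvariant (I w)) {H : Set (OForm S ℕ [])}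
    {A : OForm S ℕ []} (h : Entails H A) {θ : NameSubst S ℕ ℕ []} {w : W}
    (hH : ∀ F ∈ H, F.Forces I θ Assign.none w) : A.Forces I θ Assign.none w := by
  induction h generalizing θ w with
  | hyp h => exact hH _ h
  | conv h _ ih => exact (h.forces_iff hconv).1 (ih hH)
  | topI => trivial
  | botE _ ih => exact (ih hH).elim
  | andI _ _ ih ih' => exact ⟨ih hH, ih' hH⟩
  | andE₁ _ ih => exact (ih hH).1
  | andE₂ _ ih => exact (ih hH).2
  | orI₁ _ ih => exact .inl (ih hH)
  | orI₂ _ ih => exact .inr (ih hH)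
  | orE _ _ _ ih ih₁ ih₂ =>
    exact (ih hH).elim (fun h => ih₁ (Set.forall_mem_insert.2 ⟨h, hH⟩))
      fun h => ih₂ (Set.forall_mem_insert.2 ⟨h, hH⟩)
  | impI _ ih =>
    exact fun w' hw h => ih (Set.forall_mem_insert.2 ⟨h, fun F hF => (hH F hF).mono hmono hw⟩)
  | impE _ _ ih ih' => exact ih hH w le_rfl (ih' hH)
  | allI y hy hB _ ih =>
    exact fun t => (Form.forces_inst_update hB θ t).1
      (ih fun F hF => (Form.forces_update (hy F hF) θ t).2 (hH F hF))
  | allE t _ ih => exact (Form.forces_inst _ t θ _ w).2 (ih hH _)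
  | exI t _ ih => exact ⟨_, (Form.forces_inst _ t θ _ w).1 (ih hH)⟩
  | exE y hy hB hC _ _ ih ih' =>
    obtain ⟨t, ht⟩ := ih hH
    exact (Form.forces_update hC θ t).1 (ih' (Set.forall_mem_insert.2
      ⟨(Form.forces_inst_update hB θ t).2 ht,
        fun F hF => (Form.forces_update (hy F hF) θ t).2 (hH F hF)⟩))

theorem Form.forces_close {S : Signature.{u}} {P : Type u} {ar : P → List (Ty S.Ground)}
    {W : Type*} [Preorder W] {I : W → Interp S ar} {N : Type} {θ : NameSubst S N ℕ []} {w : W} :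
    (Γ : List (Ty S.Ground)) → {B : Form S ar N Γ} → (∀ η, B.Forces I θ η w) →
    (Form.close Γ B).Forces I θ Assign.none w
  | [], _, h => h _
  | σ :: Γ, B, h => Form.forces_close Γ (B := .all σ B) fun _ _ => h _

theorem Tm.bind_empty_bind {S : Signature.{u}} {N N' : Type} {Γ Δ Θ : List (Ty S.Ground)}
    {τ : Ty S.Ground} (t : Tm S Empty Γ τ) (η : Assign S N Γ Δ) (θ : NameSubst S N N' Θ)
    (η' : Assign S N' Δ Θ) :
    (t.bind .empty η).bind θ η' = t.bind .empty fun τ x => (η τ x).bind θ η' := by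
  rw [bind_bind, NameSubst.eq_empty fun _ _ => _]

theorem map_bind_update_of_not_occurs {S : Signature.{u}} {τ σ : Ty S.Ground}
    {l : List (Tm S ℕ [] τ)} {y : ℕ} (h : ∀ a ∈ l, ¬ a.Occurs σ y) (θ : NameSubst S ℕ ℕ [])
    (r : Tm S ℕ [] σ) :
    l.map (Tm.bind (θ.update σ y r) Assign.none) = l.map (Tm.bind θ Assign.none) :=
  List.map_congr_left fun a ha => a.bind_update_of_not_occurs (h a ha) θ r _

section Uniform
variable {S : Signature.{u}} {T : Set (ProgClause S)}

/-- `Uniform T n l B`: the goal `B` has a goal-directed proof of height at most `n` from the atoms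
in `l` and the theory `T`. The premise for `⋀` quantifies over all terms, with a bound on the height
that does not depend on the term. -/
inductive Uniform (T : Set (ProgClause S)) :
    ℕ → List (Tm S ℕ [] .atm) → Tm S ℕ [] .prp → Prop
  | hyp {n : ℕ} {l : List (Tm S ℕ [] .atm)} {a a' : Tm S ℕ [] .atm} {B : Tm S ℕ [] .prp} :
      a' ∈ l → a'.Conv a → (atomT a).Conv B → Uniform T n l B
  | tt {n : ℕ} {l : List (Tm S ℕ [] .atm)} {B : Tm S ℕ [] .prp} :
      ttT.Conv B → Uniform T n l B
  | and {n : ℕ} {l : List (Tm S ℕ [] .atm)} {b c B : Tm S ℕ [] .prp} :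
      (andT b c).Conv B → Uniform T n l b → Uniform T n l c → Uniform T (n + 1) l B
  | imp {n : ℕ} {l : List (Tm S ℕ [] .atm)} {a : Tm S ℕ [] .atm} {b B : Tm S ℕ [] .prp} :
      (impT a b).Conv B → Uniform T n (a :: l) b → Uniform T (n + 1) l B
  | all {n : ℕ} {l : List (Tm S ℕ [] .atm)} {b : Tm S ℕ [] (.arr .i .prp)} {B : Tm S ℕ [] .prp} :
      (allT b).Conv B → (∀ t, Uniform T n l (.app b t)) → Uniform T (n + 1) l B
  | prog {n : ℕ} {l : List (Tm S ℕ [] .atm)} {B : Tm S ℕ [] .prp} {c : ProgClause S}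
      (η : Assign S ℕ c.ctx []) : c ∈ T → (atomT (c.A.bind .empty η)).Conv B →
      Uniform T n l (c.G.bind .empty η) → Uniform T (n + 1) l B

namespace Uniform
variable {n : ℕ} {l : List (Tm S ℕ [] .atm)}

theorem conv {B B' : Tm S ℕ [] .prp} (h : Uniform T n l B) (hB : B.Conv B') :
    Uniform T n l B' := by
  cases h with
  | hyp h h' h'' => exact .hyp h h' (h''.trans hB)
  | tt h => exact .tt (h.trans hB)
  | and h h₁ h₂ => exact .and (h.trans hB) h₁ h₂
  | imp h h₁ => exact .imp (h.trans hB) h₁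
  | all h h₁ => exact .all (h.trans hB) h₁
  | prog η hc h h₁ => exact .prog η hc (h.trans hB) h₁

theorem mono {B : Tm S ℕ [] .prp} (h : Uniform T n l B) {m : ℕ} (hn : n ≤ m)
    {l' : List (Tm S ℕ [] .atm)} (hl : l ⊆ l') : Uniform T m l' B := by
  obtain ⟨k, rfl⟩ := Nat.exists_eq_add_of_le' hn
  clear hn
  induction h generalizing l' with
  | hyp h h' h'' => exact .hyp (hl h) h' h''
  | tt h => exact .tt h
  | and h _ _ ih ih' => exact .and h (ih hl) (ih' hl)
  | imp h _ ih => exact .imp h (ih (List.cons_subset_cons _ hl))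
  | all h _ ih => exact .all h fun t => ih t hl
  | prog η hc h _ ih => exact .prog η hc h (ih hl)

theorem bind {B : Tm S ℕ [] .prp} (h : Uniform T n l B) (θ : NameSubst S ℕ ℕ []) :
    Uniform T n (l.map (Tm.bind θ Assign.none)) (B.bind θ Assign.none) := by
  induction h generalizing θ with
  | hyp h h' h'' => exact .hyp (List.mem_map_of_mem h) (h'.bind θ _) (h''.bind θ _)
  | tt h => exact .tt (h.bind θ _)
  | and h _ _ ih ih' => exact .and (h.bind θ _) (ih θ) (ih' θ)
  | imp h _ ih => exact .imp (h.bind θ _) (ih θ)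
  | @all n l b B h _ ih =>
    obtain ⟨y, hl, hb⟩ := ((eventually_forall_mem_not_occurs l .i).and
      (b.eventually_not_occurs .i)).exists
    refine .all (h.bind θ _) fun t => ?_
    have := ih (.free .i y) (θ.update .i y t)
    rwa [map_bind_update_of_not_occurs hl, Tm.bind, b.bind_update_of_not_occurs hb, Tm.bind,
      NameSubst.update_same] at this
  | prog η hc h _ ih =>
    refine .prog (fun τ x => (η τ x).bind θ Assign.none) hc ?_ ?_
    · rw [← Tm.bind_empty_bind]
      exact h.bind θ _
    · rw [← Tm.bind_empty_bind]
      exact ih θ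

theorem forall_of_fresh {b : Tm S ℕ [] (.arr .i .prp)} {y : ℕ} (hl : ∀ a ∈ l, ¬ a.Occurs .i y)
    (hb : ¬ b.Occurs .i y) (h : Uniform T n l (.app b (.free .i y))) (t : Tm S ℕ [] .i) :
    Uniform T n l (.app b t) := by
  have := h.bind (NameSubst.update .free .i y t)
  rw [map_bind_update_of_not_occurs hl, Tm.bind, b.bind_update_of_not_occurs hb, Tm.bind,
    NameSubst.update_same, b.bind_id_none] at this
  rwa [List.map_congr_left fun a _ => a.bind_id_none, List.map_id'] at this

end Uniform

/-- The worlds of the Kripke structure of goal-directed provability: lists of atoms, ordered by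
inclusion of their sets of members. -/
structure World (S : Signature.{u}) : Type u where
  atoms : List (Tm S ℕ [] .atm)

instance : Preorder (World S) := Preorder.lift fun w => {a | a ∈ w.atoms}

/-- The Kripke structure of goal-directed provability: an atom holds at the world `w` if it has a
goal-directed proof, of any height, from the atoms in `w`. -/
def uniformInterp (T : Set (ProgClause S)) (w : World S) : Interp S (objArity S) :=
  fun _ (ts : Tms S ℕ [] [.atm]) =>
    match ts with
    | .cons a .nil => ∃ n, Uniform T n w.atoms (atomT a)

theorem uniformInterp_mono : Monotone (uniformInterp T) := fun _ _ h _ (ts : Tms S ℕ [] [.atm]) =>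
  match ts with
  | .cons _ .nil => fun ⟨n, hn⟩ => ⟨n, hn.mono le_rfl h⟩

theorem convInvariant_uniformInterp (w : World S) : ConvInvariant (uniformInterp T w) :=
  fun _ (ts ts' : Tms S ℕ [] [.atm]) h =>
    match ts, ts', h with
    | .cons _ .nil, .cons _ .nil, .cons h _ => fun ⟨n, hn⟩ => ⟨n, hn.conv (.app (.refl _) h)⟩

theorem Translates.exists_uniform_of_forces {N : Type} {Γ : List (Ty S.Ground)} {B : Tm S N Γ .prp}
    {φ : OForm S N Γ} (h : Translates B φ) {θ : NameSubst S N ℕ []} {η : Assign S ℕ Γ []}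
    {w : World S} (hφ : φ.Forces (uniformInterp T) θ η w) :
    ∃ n, Uniform T n w.atoms (B.bind θ η) := by
  induction h generalizing w with
  | atom a => exact hφ
  | tt => exact ⟨0, .tt (.refl _)⟩
  | and _ _ ih ih' =>
    obtain ⟨n, hn⟩ := ih hφ.1
    obtain ⟨n', hn'⟩ := ih' hφ.2
    exact ⟨max n n' + 1, .and (.refl _) (hn.mono (le_max_left _ _) (List.Subset.refl _))
      (hn'.mono (le_max_right _ _) (List.Subset.refl _))⟩
  | imp a _ ih =>
    obtain ⟨n, hn⟩ := ih (hφ ⟨a.bind θ η :: w.atoms⟩ (List.subset_cons_self _ _)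
      ⟨0, .hyp List.mem_cons_self (.refl _) (.refl _)⟩)
    exact ⟨n + 1, .imp (.refl _) hn⟩
  | @all Γ b φ _ ih =>
    obtain ⟨y, hl, hb⟩ := ((eventually_forall_mem_not_occurs w.atoms .i).and
      (((Tm.lam b).bind θ η).eventually_not_occurs .i)).exists
    obtain ⟨n, hn⟩ := ih (hφ (.free .i y))
    refine ⟨n + 1, .all (.refl _) (Uniform.forall_of_fresh hl hb (hn.conv ?_))⟩
    rw [← Tm.bind_lift_inst]
    exact (Tm.Conv.beta _ _).symm
  | conv h _ ih => exact (ih hφ).imp fun _ hn => hn.conv (h.bind θ η)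

theorem ProgClause.forces_toForm (c : ProgClause S) (hc : c ∈ T) (θ : NameSubst S ℕ ℕ [])
    (w : World S) : c.toForm.Forces (uniformInterp T) θ Assign.none w := by
  rw [ProgClause.toForm, Form.ofClosed, Form.forces_bind, Assign.eq_none fun τ x => _,
    NameSubst.eq_empty fun τ n => _]
  refine Form.forces_close _ fun η w' _ h => ?_
  obtain ⟨n, hn⟩ := c.translates.exists_uniform_of_forces h
  exact ⟨n + 1, .prog η hc (.refl _) hn⟩

theorem Entails.exists_uniform {l : List (Tm S ℕ [] .atm)} {B : Tm S ℕ [] .prp}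
    {φ : OForm S ℕ []} (h : Entails (hypotheses T l) φ) (hB : Translates B φ) :
    ∃ n, Uniform T n l B := by
  have hyps : ∀ F ∈ hypotheses T l, F.Forces (uniformInterp T) .free Assign.none ⟨l⟩ := by
    rintro F (hF | ⟨c, hc, rfl⟩)
    · obtain ⟨a, ha, rfl⟩ := List.mem_map.1 hF
      exact ⟨0, .hyp ha (.refl a) (by rw [a.bind_id_none]; exact .refl _)⟩
    · exact c.forces_toForm hc _ _
  obtain ⟨n, hn⟩ := hB.exists_uniform_of_forces
    (h.forces uniformInterp_mono convInvariant_uniformInterp hyps)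
  rw [B.bind_id_none] at hn
  exact ⟨n, hn⟩

end Uniform

/-! ## Goal-directed proofs are derivable in the meta-logic -/

section Derivability
variable {S : Signature.{u}} {D : Set (Clause S)} {T : Set (ProgClause S)}
  {Γ : Multiset (MForm S ℕ [])}

theorem Derivable.allR_of_forall {τ : Ty S.Ground} {B : MForm S ℕ [τ]}
    (h : ∀ t, Derivable D Γ (B.inst t)) : Derivable D Γ (.all τ B) := by
  have hΓ : ∀ᶠ y in Filter.cofinite, ∀ F ∈ Γ, ¬ F.Occurs τ y :=
    (Filter.eventually_all_finite Γ.finite_toSet).2 fun F _ => F.eventually_not_occurs τ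
  obtain ⟨y, hy, hB⟩ := (hΓ.and (B.eventually_not_occurs τ)).exists
  exact .allR y hy hB (h _)

theorem derivable_natF_num (n : ℕ) : Derivable D Γ (natF (num n)) := by
  induction n with
  | zero => exact .natR_zero
  | succ n ih => exact .natR_suc ih

theorem derivable_prv {n : ℕ} {L : Tm S ℕ [] .atmlst} {B : Tm S ℕ [] .prp}
    (h : Derivable D Γ (seqF (num n) L B)) : Derivable D Γ (prv L B) := by
  refine .exR (num n) (.andR (derivable_natF_num n) ?_)
  rw [← L.wk_inst (num n), ← B.wk_inst (num n)] at h
  exact h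

namespace Encodes
variable {n : Tm S ℕ [] .nt} {L : Tm S ℕ [] .atmlst} {a : Tm S ℕ [] .atm} {b : Tm S ℕ [] .prp}

theorem derivable_elementF (hD : Encodes D T) {l : List (Tm S ℕ [] .atm)} {a' : Tm S ℕ [] .atm}
    (hl : a' ∈ l) (h : a'.Conv a) : Derivable D Γ (elementF a (listT l)) := by
  induction l with
  | nil => cases hl
  | cons a₀ l ih =>
    rcases List.mem_cons.1 hl with rfl | hl
    · exact .defR .element _ ⟨[.atm, .atmlst], .element, .cons v0 (.cons (consT v0 v1) .nil), .top⟩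
        ((Assign.none.cons (listT l)).cons a) nofun
        ((hD.mem_iff_of_element _ rfl).2 (.inr (.inr (.inr (.inl rfl)))))
        (.atom _ (.cons (.refl _) (.cons (.app (.app (.refl _) h) (.refl _)) .nil))) .topR
    · exact .defR .element _ ⟨[.atm, .atm, .atmlst], .element,
          .cons v0 (.cons (consT v1 v2) .nil), elementF v0 v2⟩
        (((Assign.none.cons (listT l)).cons a₀).cons a) nofun
        ((hD.mem_iff_of_element _ rfl).2 (.inr (.inr (.inr (.inr (.inl rfl))))))
        (.refl _) (ih hl)

theorem derivable_progF (hD : Encodes D T) {c : ProgClause S} (hc : c ∈ T)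
    (η : Assign S ℕ c.ctx []) :
    Derivable D Γ (progF (c.A.bind .empty η) (c.G.bind .empty η)) :=
  .defR .prog _ c.toClause η nofun ((hD.mem_iff_of_prog _ rfl).2 ⟨c, hc, rfl⟩) (.refl _) .topR

theorem derivable_seqF_atomT_of_element (hD : Encodes D T) {a' : Tm S ℕ [] .atm}
    (h : Derivable D Γ (elementF a (consT a' L))) :
    Derivable D Γ (seqF n (consT a' L) (atomT a)) := by
  refine .defR .seq _ _ ((((Assign.none.cons a).cons L).cons a').cons n) nofun
    (hD.defIntuit_subset (.inl rfl)) (.refl _) ?_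
  exact h

theorem derivable_seqF_ttT (hD : Encodes D T) : Derivable D Γ (seqF n L ttT) :=
  .defR .seq _ _ ((Assign.none.cons L).cons n) nofun
    (hD.defIntuit_subset (.inr (.inl rfl))) (.refl _) .topR

theorem derivable_seqF_andT (hD : Encodes D T) {c : Tm S ℕ [] .prp}
    (hb : Derivable D Γ (seqF n L b)) (hc : Derivable D Γ (seqF n L c)) :
    Derivable D Γ (seqF (sucT n) L (andT b c)) := by
  refine .defR .seq _ _ ((((Assign.none.cons c).cons b).cons L).cons n) nofun
    (hD.defIntuit_subset (.inr (.inr (.inl rfl)))) (.refl _) ?_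
  exact .andR hb hc

theorem derivable_seqF_impT (hD : Encodes D T) (h : Derivable D Γ (seqF n (consT a L) b)) :
    Derivable D Γ (seqF (sucT n) L (impT a b)) := by
  refine .defR .seq _ _ ((((Assign.none.cons b).cons a).cons L).cons n) nofun
    (hD.defIntuit_subset (.inr (.inr (.inr (.inl rfl))))) (.refl _) ?_
  exact h

theorem derivable_seqF_allT (hD : Encodes D T) {b : Tm S ℕ [] (.arr .i .prp)}
    (h : ∀ t, Derivable D Γ (seqF n L (.app b t))) :
    Derivable D Γ (seqF (sucT n) L (allT b)) := by
  refine .defR .seq _ _ (((Assign.none.cons b).cons L).cons n) nofun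
    (hD.defIntuit_subset (.inr (.inr (.inr (.inr (.inl rfl)))))) (.refl _)
    (.allR_of_forall fun t => ?_)
  have h := h t
  rw [← n.wk_inst t, ← L.wk_inst t, ← b.wk_inst t] at h
  exact h

theorem derivable_seqF_atomT_of_prog (hD : Encodes D T) (ha : Derivable D Γ (progF a b))
    (hb : Derivable D Γ (seqF n L b)) : Derivable D Γ (seqF (sucT n) L (atomT a)) := by
  refine .defR .seq _ _ (((Assign.none.cons a).cons L).cons n) nofun
    (hD.defIntuit_subset (.inr (.inr (.inr (.inr (.inr rfl)))))) (.refl _) (.exR b (.andR ?_ ?_))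
  · rw [← a.wk_inst b] at ha
    exact ha
  · rw [← n.wk_inst b, ← L.wk_inst b] at hb
    exact hb

end Encodes

theorem Uniform.derivable (hD : Encodes D T) {n : ℕ} {l : List (Tm S ℕ [] .atm)}
    {B : Tm S ℕ [] .prp} (h : Uniform T n l B) : Derivable D 0 (seqF (num n) (listT l) B) := by
  have conv {n : ℕ} {l : List (Tm S ℕ [] .atm)} {b b' : Tm S ℕ [] .prp} (hb : b.Conv b')
      (h : Derivable D 0 (seqF (num n) (listT l) b)) :
      Derivable D 0 (seqF (num n) (listT l) b') :=
    h.conv .zero (.atom _ (.cons (.refl _) (.cons (.refl _) (.cons hb .nil))))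
  induction h with
  | @hyp n l a a' B hl ha hB =>
    cases l with
    | nil => cases hl
    | cons a₀ l => exact conv hB (hD.derivable_seqF_atomT_of_element (hD.derivable_elementF hl ha))
  | tt hB => exact conv hB hD.derivable_seqF_ttT
  | and hB _ _ ih ih' => exact conv hB (hD.derivable_seqF_andT ih ih')
  | imp hB _ ih => exact conv hB (hD.derivable_seqF_impT ih)
  | all hB _ ih => exact conv hB (hD.derivable_seqF_allT ih)
  | prog η hc hB _ ih =>
    exact conv hB (hD.derivable_seqF_atomT_of_prog (hD.derivable_progF hc η) ih)

end Derivability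

theorem theory_eq_image {S : Signature.{u}} (T : List (ProgClause S)) :
    theory T = ProgClause.toForm '' {c | c ∈ T} := by
  ext
  simp only [theory, Set.mem_ofPred_eq, Set.mem_image, eq_comm]

theorem defProg_eq_image {S : Signature.{u}} (T : List (ProgClause S)) :
    defProg T = ProgClause.toClause '' {c | c ∈ T} := by
  ext
  simp only [defProg, Set.mem_ofPred_eq, Set.mem_image, eq_comm]

end FOLambda

theorem mainTheorem1_general {S : FOLambda.Signature.{u}} {T : Set (FOLambda.ProgClause S)}
    {D : Set (FOLambda.Clause S)} (hD : FOLambda.Encodes D T) {lvl : FOLambda.Pred S → ℕ}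
    (hlvl : ∀ c ∈ D, c.body.level lvl ≤ lvl c.pred)
    {L : FOLambda.Tm S ℕ [] .atmlst} {M : Multiset (FOLambda.OForm S ℕ [])}
    (hL : FOLambda.TranslatesList L M)
    {B : FOLambda.Tm S ℕ [] .prp} {φ : FOLambda.OForm S ℕ []} (hB : FOLambda.Translates B φ) :
    FOLambda.Derivable D 0 (FOLambda.prv L B) ↔
      FOLambda.Entails ({F | F ∈ M} ∪ FOLambda.ProgClause.toForm '' T) φ := by
  obtain ⟨l, hl, rfl⟩ := hL.exists_list
  refine ⟨hD.entails_of_derivable_prv hlvl hl hB, fun h => ?_⟩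
  obtain ⟨n, hn⟩ := FOLambda.Entails.exists_uniform h hB
  exact FOLambda.derivable_prv ((hn.derivable hD).conv .zero
    (.atom _ (.cons (.refl _) (.cons hl (.cons (.refl _) .nil)))))

theorem mainTheorem1 {S : FOLambda.Signature.{u}}
    (T : List (FOLambda.ProgClause S))
    (E D : Set (FOLambda.Clause S))
    (hD : D = FOLambda.defNat S ∪ FOLambda.defList S ∪ FOLambda.defIntuit S ∪
      FOLambda.defProg T ∪ E)
    (hE : ∀ c ∈ E, c.pred ≠ .nat ∧ c.pred ≠ .seq ∧ c.pred ≠ .element ∧ c.pred ≠ .prog)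
    (lvl : FOLambda.Pred S → ℕ)
    (hlvl : ∀ c ∈ D, c.body.level lvl ≤ lvl c.pred)
    (L : FOLambda.Tm S ℕ [] .atmlst) (M : Multiset (FOLambda.OForm S ℕ []))
    (hL : FOLambda.TranslatesList L M)
    (B : FOLambda.Tm S ℕ [] .prp) (φ : FOLambda.OForm S ℕ [])
    (hB : FOLambda.Translates B φ) :
    FOLambda.Derivable D 0 (FOLambda.prv L B) ↔
      FOLambda.Entails ({F | F ∈ M} ∪ FOLambda.theory T) φ := by
  rw [FOLambda.defProg_eq_image] at hD
  rw [FOLambda.theory_eq_image]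
  exact mainTheorem1_general (hD ▸ .of_union fun c hc => (hE c hc).2) hlvl hL hB
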